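/- Write $\mathbb{C}^3=\mathbb{R}^6$, $\omega=\sum_j dx_j\wedge dy_j$, and let $S^5$ be the unit sphere of $\mathbb{C}^3$. A smooth immersion $u:\mathbb{R}^2\to S^5$ is *Legendrian* if $\omega(u,du(v))=0$ for all tangent vectors $v$, and *minimal* if its mean curvature vector in $S^5$ vanishes. For $\alpha\in[0,1]$ let $(\lambda_1,\lambda_2,\lambda_3)=(1,\alpha,-1-\alpha)$, $A=i\,\mathrm{diag}(\lambda_1,\lambda_2,\lambda_3)$ and $(\mu_1,\mu_2,\mu_3)=(1,1,1)\times(\lambda_1,\lambda_2,\lambda_3)=(-1-2\alpha,\,2+\alpha,\,\alpha-1)$. For each $\theta\in\mathbb{R}$ define maps $u_{\alpha,J}(s,t)=e^{As}z(t)$, $(s,t)\in\mathbb{R}^2$, as follows. * For $J=0$ and $\alpha\in(0,1]$, put $r=\sqrt{1+2\alpha}$, $k=\sqrt{(1-\alpha^2)/(1+2\alpha)}$, and let $$z(t)=\Big(e^{-i(\theta+\pi/2)}\sqrt{\tfrac{1+\alpha}{2+\alpha}}\,\mathrm{cn}(rt,k),\ \sqrt{\tfrac{1+\alpha}{1+2\alpha}}\,\mathrm{sn}(rt,k),\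 \sqrt{\tfrac{1}{2+\alpha}}\,\mathrm{dn}(rt,k)\Big)$$ with the Jacobi elliptic functions of modulus $k$. * For $0<J\le \frac1{3\sqrt3}$, let $\gamma_+$ be the smallest nonnegative root $\gamma$ of $\prod_{j=1}^3(\gamma\mu_j+\frac13)=J^2$, let $R_j=\sqrt{\gamma_+\mu_j+\frac13}$ and $(\theta_1,\theta_2,\theta_3)=(-\theta,0,0)$, and let $z:\mathbb{R}\to\mathbb{C}^3$ be the solution of the C. Neumann system $$\ddot z_j-\lambda_j^2z_j=-\big(|Az|^2+|\dot z|^2\big)z_j,\qquad j=1,2,3,$$ with $z_j(0)=R_je^{i\theta_j}$ and $\dot z_j(0)=i\,\frac{J\mu_j}{R_j}\,e^{i\theta_j}$. **Theorem 5.** (i) For every $\alpha\in\mathbb{Q}\cap(0,1]$ and every $\theta$, the map $u_{\alpha,0}$ is doubly periodic with respect to a lattice $\Lambda\subset\mathbb{R}^2$ (of rank two) and descends to a minimal Legendrian immersion of the torus $\mathbb{R}^2/\Lambda$ into $S^5$. (ii) There is a dense subset $D$ of the interval $\big(0,\frac1{3\sqrt3}\big)$ such that for every $J\in D$ and every $\theta$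 the solution $z$ defining $u_{0,J}$ exists and is unique, and $u_{0,J}$ is doubly periodic with respect to a lattice $\Lambda\subset\mathbb{R}^2$ (of rank two) and descends to a minimal Legendrian immersion of the torus $\mathbb{R}^2/\Lambda$ into $S^5$. -/

import Mathlib

open scoped ContDiff

noncomputable section

namespace LegendrianTori

/-- `ℂ³` with its standard Hermitian structure; it is also a real inner product space, with
`inner ℝ z w = Re ∑ conj (z j) * w j`. -/
abbrev C3 : Type := EuclideanSpace ℂ (Fin 3)

/-! ### Minimal Legendrian immersions of the plane into the unit sphere of `ℂ³` -/

/-- The standard symplectic form `∑ dx_j ∧ dy_j` of `ℂ³`. -/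
def omega (z w : C3) : ℝ :=
  ∑ j, ((z j).re * (w j).im - (z j).im * (w j).re)

/-- The coordinate vectors `∂/∂s`, `∂/∂t` of the plane. -/
def coordVec : Fin 2 → ℝ × ℝ := ![(1, 0), (0, 1)]

/-- The partial derivative `∂_i u`. -/
def partialDeriv (i : Fin 2) (u : ℝ × ℝ → C3) : ℝ × ℝ → C3 :=
  fun x => fderiv ℝ u x (coordVec i)

/-- The first fundamental form `g_ij = ⟨∂_i u, ∂_j u⟩`. -/
def firstForm (u : ℝ × ℝ → C3) (x : ℝ × ℝ) : Matrix (Fin 2) (Fin 2) ℝ :=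
  Matrix.of fun i j => inner ℝ (partialDeriv i u x) (partialDeriv j u x)

/-- The real subspace spanned by the position vector `u` and the tangent plane of the surface.
Its orthogonal complement is the normal space of the surface in the unit sphere. -/
def tangentCone (u : ℝ × ℝ → C3) (x : ℝ × ℝ) : Submodule ℝ C3 :=
  Submodule.span ℝ {u x, partialDeriv 0 u x, partialDeriv 1 u x}

/-- The second fundamental form, in the unit sphere, of a surface in the unit sphere: the
component of `∂_i ∂_j u` that is normal to the surface and tangent to the sphere. -/
def secondForm (u : ℝ × ℝ → C3) (x : ℝ × ℝ) (i j : Fin 2) : C3 :=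
  (tangentCone u x)ᗮ.starProjection (partialDeriv i (partialDeriv j u) x)

/-- The mean curvature vector, in the unit sphere, of an immersed surface in the unit sphere. -/
def meanCurvature (u : ℝ × ℝ → C3) (x : ℝ × ℝ) : C3 :=
  (1 / 2 : ℝ) • ∑ i, ∑ j, (firstForm u x)⁻¹ i j • secondForm u x i j

/-- `u` is a smooth immersion of the plane into the unit sphere of `ℂ³`, it is Legendrian (the
contact form `ι_X ω`, with `X` the Euler field, pulls back to zero), and it is minimal in the
sphere (its mean curvature vanishes). -/
structure IsMinimalLegendrianImmersion (u : ℝ × ℝ → C3) : Prop where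
  smooth : ContDiff ℝ ∞ u
  mem_sphere : ∀ x, u x ∈ Metric.sphere (0 : C3) 1
  immersion : ∀ x, Function.Injective (fderiv ℝ u x)
  legendrian : ∀ x v, omega (u x) (fderiv ℝ u x v) = 0
  minimal : ∀ x, meanCurvature u x = 0

/-! ### Doubly periodic maps and tori -/

/-- The lattice in the plane generated by a basis. -/
def lattice (b : Module.Basis (Fin 2) ℝ (ℝ × ℝ)) : Submodule ℤ (ℝ × ℝ) :=
  Submodule.span ℤ (Set.range b)

/-- The torus `ℝ² / Λ`. -/
abbrev PlaneTorus (b : Module.Basis (Fin 2) ℝ (ℝ × ℝ)) : Type :=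
  (ℝ × ℝ) ⧸ lattice b

/-- `u` is periodic with respect to the lattice generated by the basis `b`. -/
def IsPeriodicWith (b : Module.Basis (Fin 2) ℝ (ℝ × ℝ)) (u : ℝ × ℝ → C3) : Prop :=
  ∀ v ∈ lattice b, ∀ x, u (x + v) = u x

/-- A minimal Legendrian immersion of the torus `ℝ² / Λ` into the unit sphere of `ℂ³`. The smooth
structure of `ℝ² / Λ` is the one for which the projection from `ℝ²` is a local diffeomorphism, and
all the conditions are local, so they can be read in the charts given by the projection. -/
def IsMinimalLegendrianTorus {b : Module.Basis (Fin 2) ℝ (ℝ × ℝ)}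
    (f : PlaneTorus b → Metric.sphere (0 : C3) 1) : Prop :=
  IsMinimalLegendrianImmersion fun x => (f (Submodule.Quotient.mk x) : C3)

/-- `u` is doubly periodic, and it descends to a minimal Legendrian immersion of a torus
`ℝ² / Λ`, where `Λ` is a lattice of periods of `u`. -/
def GivesMinimalLegendrianTorus (u : ℝ × ℝ → C3) : Prop :=
  ∃ b : Module.Basis (Fin 2) ℝ (ℝ × ℝ), IsPeriodicWith b u ∧
    ∃ f : PlaneTorus b → Metric.sphere (0 : C3) 1,
      (∀ x, (f (Submodule.Quotient.mk x) : C3) = u x) ∧ IsMinimalLegendrianTorus f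

/-! ### The equivariant family -/

/-- The weights `λ = (1, α, -1 - α)` of `A = i diag (1, α, -1 - α)`. -/
def weight (α : ℝ) : Fin 3 → ℝ := ![1, α, -1 - α]

/-- The vector `μ = (1, 1, 1) × λ`. -/
def mu (α : ℝ) : Fin 3 → ℝ := ![-1 - 2 * α, 2 + α, α - 1]

/-- The map `u(s, t) = e^{A s} z(t)`. -/
def equivariantMap (α : ℝ) (z : ℝ → C3) : ℝ × ℝ → C3 :=
  fun p => WithLp.toLp 2 fun j => Complex.exp (Complex.I * (weight α j * p.1 : ℝ)) * z p.2 j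

/-- `z` solves the C. Neumann system `z_j'' - λ_j² z_j = -(|A z|² + |z'|²) z_j`. -/
def IsNeumannSolution (α : ℝ) (z : ℝ → C3) : Prop :=
  ContDiff ℝ 2 z ∧ ∀ t j,
    deriv (deriv z) t j - ((weight α j ^ 2 : ℝ) : ℂ) * z t j
      = -(((∑ i, weight α i ^ 2 * ‖z t i‖ ^ 2) + ‖deriv z t‖ ^ 2 : ℝ) : ℂ) * z t j

/-- `R_j²` as a function of `γ`. -/
def radiusSq (α γ : ℝ) (j : Fin 3) : ℝ := γ * mu α j + 1 / 3

/-- The smallest nonnegative root `γ` of `R_1² R_2² R_3² = J²`. -/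
def gammaPlus (α J : ℝ) : ℝ :=
  sInf {γ : ℝ | 0 ≤ γ ∧ ∏ j, radiusSq α γ j = J ^ 2}

/-- The initial radii `R_j(0)`. -/
def initialRadius (α J : ℝ) (j : Fin 3) : ℝ := √(radiusSq α (gammaPlus α J) j)

/-- The initial angles `(-θ, 0, 0)`. -/
def initialAngle (θ : ℝ) : Fin 3 → ℝ := ![-θ, 0, 0]

/-- For `0 ≤ α ≤ 1` and `0 < J ≤ 1 / (3 √3)`: the curve `z` with `u_{α,J}(s, t) = e^{A s} z(t)`.
It solves the Neumann system, and in polar coordinates `z_j = R_j e^{i θ_j}` it has at time `0`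
the given radii and angles, and the velocities `R_j' = 0`, `θ_j' = J μ_j / R_j²`. -/
structure IsProfile (θ α J : ℝ) (z : ℝ → C3) : Prop where
  neumann : IsNeumannSolution α z
  position : ∀ j, z 0 j = initialRadius α J j * Complex.exp (Complex.I * initialAngle θ j)
  velocity : ∀ j, deriv z 0 j
    = Complex.I * (J * mu α j / initialRadius α J j : ℝ)
        * Complex.exp (Complex.I * initialAngle θ j)

/-- The incomplete elliptic integral of the first kind of modulus `k`. -/
def ellipticF (k φ : ℝ) : ℝ := ∫ x in (0 : ℝ)..φ, 1 / √(1 - k ^ 2 * Real.sin x ^ 2)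

/-- The Jacobi amplitude of modulus `k`, `0 ≤ k < 1`: the inverse function of `ellipticF k`. -/
def jacobiAm (k : ℝ) : ℝ → ℝ := Function.invFun (ellipticF k)

/-- The Jacobi elliptic function `sn`. -/
def jacobiSn (k x : ℝ) : ℝ := Real.sin (jacobiAm k x)

/-- The Jacobi elliptic function `cn`. -/
def jacobiCn (k x : ℝ) : ℝ := Real.cos (jacobiAm k x)

/-- The Jacobi elliptic function `dn`. -/
def jacobiDn (k x : ℝ) : ℝ := √(1 - k ^ 2 * jacobiSn k x ^ 2)

/-- The modulus `k` for `J = 0`. -/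
def modulusZero (α : ℝ) : ℝ := √((1 - α ^ 2) / (1 + 2 * α))

/-- The frequency `r` for `J = 0`. -/
def rateZero (α : ℝ) : ℝ := √(1 + 2 * α)

/-- For `0 < α ≤ 1`: the curve `z` with `u_{α,0}(s, t) = e^{A s} z(t)`. -/
def profileZero (θ α : ℝ) : ℝ → C3 := fun t =>
  !₂[Complex.exp (-(Complex.I * (θ + Real.pi / 2 : ℝ)))
        * (√((1 + α) / (2 + α)) * jacobiCn (modulusZero α) (rateZero α * t) : ℝ),
     (√((1 + α) / (1 + 2 * α)) * jacobiSn (modulusZero α) (rateZero α * t) : ℝ),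
     (√(1 / (2 + α)) * jacobiDn (modulusZero α) (rateZero α * t) : ℝ)]

end LegendrianTori

end

/-! The flow `e^{As}` is unitary, so every condition on `u(s,t) = e^{As} z(t)` becomes a condition
on `z`. The partial derivatives are `e^{As} A z` and `e^{As} z'`, and the coordinates are conformal
when `|Az| = |z'|` and `Az ⊥ z'`. The Neumann system makes `u_ss + u_tt` a multiple of `u`, which
has no component normal to the surface inside the sphere, so the mean curvature vanishes
(`meanCurvature_eq_zero`, `isMinimalLegendrianImmersion_equivariantMap`).

For `J = 0` the coordinates of `z` are constant phases times multiples of `cn`, `sn`, `dn`. All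
conditions reduce to identities between these functions; `z` is periodic, and rationality of `α`
makes `e^{As}` periodic.

For `α = 0` the flow is always periodic, and everything is governed by `x = |z₂|²`, with `x'^2 = 4
(x (1 - x)² - 4 J²)`. The sum of the arguments of the three coordinates, taken relative to their
initial phases, is `arctan (x' / (4 J))`, a periodic function. Hence the angles of `z₁` and `z₃` are
determined by that of `z₂` (`hasDerivAt_outerAngle`), and the surface closes up as soon as one
number, the rotation angle of `z₂` over a period of `x`, is a rational multiple of `2 π`.

Setting `J = e √(1 + e) / 2` factors the cubic: `1 + e` is one root and the other two have product
`e²` and sum `1 - e`. So `2 e² / x` oscillates as `1 - e - h cos φ`, and the rotation angle is an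
integral of a smooth density over `0 ≤ φ ≤ 2 π`. It is strictly increasing in `e`: a positive
multiple of the derivative of the density equals a nonnegative function plus the `φ`-derivative of a
periodic one (`hasDerivAt_corrector`). Being continuous and injective, it takes rational multiples
of `2 π` on a dense set of `e`, hence for a dense set of `J`. Uniqueness of `z` is that of an ODE
with smooth right-hand side. -/

noncomputable section

namespace LegendrianTori

/-! ### Equivariant surfaces -/

/-- The curve `A z`, with `A = i diag (1, α, -1 - α)`. -/
def weightAct (α : ℝ) (z : ℝ → C3) : ℝ → C3 :=
  fun t => WithLp.toLp 2 fun j => Complex.I * (weight α j : ℂ) * z t j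

theorem hasDerivAt_euclidean {z : ℝ → C3} {w : C3} {t : ℝ} :
    HasDerivAt z w t ↔ ∀ j, HasDerivAt (fun t => z t j) (w j) t := by
  rw [hasDerivAt_iff_hasFDerivAt, ← hasFDerivWithinAt_univ, hasFDerivWithinAt_piLp]
  refine forall_congr' fun j => ?_
  rw [hasDerivAt_iff_hasFDerivAt, hasFDerivWithinAt_univ]
  constructor <;> intro h <;> convert h using 1 <;> ext <;> simp

theorem hasFDerivAt_equivariantMap (α : ℝ) {z z' : ℝ → C3} (hz : ∀ t, HasDerivAt z (z' t) t)
    (p : ℝ × ℝ) :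
    HasFDerivAt (equivariantMap α z)
      ((ContinuousLinearMap.fst ℝ ℝ ℝ).smulRight (equivariantMap α (weightAct α z) p) +
        (ContinuousLinearMap.snd ℝ ℝ ℝ).smulRight (equivariantMap α z' p)) p := by
  rw [← hasFDerivWithinAt_univ, hasFDerivWithinAt_piLp]
  intro j
  rw [hasFDerivWithinAt_univ]
  have h1 : HasFDerivAt (fun p : ℝ × ℝ => z p.2 j)
      ((ContinuousLinearMap.snd ℝ ℝ ℝ).smulRight (z' p.2 j)) p := by
    have := (hasDerivAt_euclidean.1 (hz p.2) j).hasFDerivAt.comp p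
      (hasFDerivAt_snd (𝕜 := ℝ) (p := p))
    refine HasFDerivAt.congr_fderiv this ?_
    ext <;> simp
  have h2 : HasFDerivAt (fun p : ℝ × ℝ => Complex.exp (Complex.I * (weight α j * p.1 : ℝ)))
      ((ContinuousLinearMap.fst ℝ ℝ ℝ).smulRight
        (Complex.exp (Complex.I * (weight α j * p.1 : ℝ)) * (Complex.I * weight α j))) p := by
    have h3 : HasDerivAt (fun s : ℝ => Complex.exp (Complex.I * (weight α j * s : ℝ)))
        (Complex.exp (Complex.I * (weight α j * p.1 : ℝ)) * (Complex.I * weight α j)) p.1 := by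
      have h4 : HasDerivAt (fun s : ℝ => ((weight α j * s : ℝ) : ℂ)) (weight α j : ℂ) p.1 := by
        have := ((hasDerivAt_id p.1).const_mul (weight α j)).ofReal_comp
        simpa using this
      exact (h4.const_mul Complex.I).cexp
    have := h3.hasFDerivAt.comp p (hasFDerivAt_fst (𝕜 := ℝ) (p := p))
    refine HasFDerivAt.congr_fderiv this ?_
    ext <;> simp
  have := h2.mul h1
  refine this.congr_fderiv ?_
  ext
  · simp [equivariantMap, weightAct]
    ring
  · simp [equivariantMap, weightAct]

theorem fderiv_equivariantMap (α : ℝ) {z z' : ℝ → C3} (hz : ∀ t, HasDerivAt z (z' t) t)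
    (p v : ℝ × ℝ) :
    fderiv ℝ (equivariantMap α z) p v =
      v.1 • equivariantMap α (weightAct α z) p + v.2 • equivariantMap α z' p := by
  rw [(hasFDerivAt_equivariantMap α hz p).fderiv]
  simp

theorem partialDeriv_zero_equivariantMap (α : ℝ) {z z' : ℝ → C3}
    (hz : ∀ t, HasDerivAt z (z' t) t) :
    partialDeriv 0 (equivariantMap α z) = equivariantMap α (weightAct α z) := by
  ext p : 1
  simp [partialDeriv, fderiv_equivariantMap α hz, coordVec]

theorem partialDeriv_one_equivariantMap (α : ℝ) {z z' : ℝ → C3}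
    (hz : ∀ t, HasDerivAt z (z' t) t) :
    partialDeriv 1 (equivariantMap α z) = equivariantMap α z' := by
  ext p : 1
  simp [partialDeriv, fderiv_equivariantMap α hz, coordVec]

theorem hasDerivAt_weightAct (α : ℝ) {z z' : ℝ → C3} (hz : ∀ t, HasDerivAt z (z' t) t) (t : ℝ) :
    HasDerivAt (weightAct α z) (weightAct α z' t) t := by
  rw [hasDerivAt_euclidean]
  intro j
  exact (hasDerivAt_euclidean.1 (hz t) j).const_mul _

theorem contDiff_equivariantMap (α : ℝ) {z : ℝ → C3} (hz : ContDiff ℝ ∞ z) :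
    ContDiff ℝ ∞ (equivariantMap α z) := by
  rw [contDiff_piLp] at hz ⊢
  intro j
  have h1 : ContDiff ℝ ∞ fun p : ℝ × ℝ => z p.2 j := (hz j).comp contDiff_snd
  have h2 : ContDiff ℝ ∞ fun p : ℝ × ℝ => ((weight α j * p.1 : ℝ) : ℂ) :=
    Complex.ofRealCLM.contDiff.comp (contDiff_const.mul contDiff_fst)
  exact ((contDiff_const.mul h2).cexp).mul h1

/-- Each factor `e^{i λ_j s}` has modulus one, so the `s`-dependence disappears from every metric
quantity. -/
theorem inner_equivariantMap (α : ℝ) (z w : ℝ → C3) (p : ℝ × ℝ) :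
    inner ℝ (equivariantMap α z p) (equivariantMap α w p) = inner ℝ (z p.2) (w p.2) := by
  simp only [PiLp.inner_apply, equivariantMap]
  refine Finset.sum_congr rfl fun j _ => ?_
  simp only [Complex.inner, map_mul]
  have h : (starRingEnd ℂ) (Complex.exp (Complex.I * (weight α j * p.1 : ℝ))) *
      Complex.exp (Complex.I * (weight α j * p.1 : ℝ)) = 1 := by
    rw [mul_comm, Complex.mul_conj, Complex.normSq_eq_norm_sq, mul_comm Complex.I,
      Complex.norm_exp_ofReal_mul_I]
    simp
  congr 1
  linear_combination (starRingEnd ℂ (z p.2 j) * w p.2 j) * h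

theorem norm_equivariantMap (α : ℝ) (z : ℝ → C3) (p : ℝ × ℝ) :
    ‖equivariantMap α z p‖ = ‖z p.2‖ := by
  rw [norm_eq_sqrt_real_inner, inner_equivariantMap, ← norm_eq_sqrt_real_inner]

theorem inner_eq_sum (z w : C3) :
    inner ℝ z w = ∑ j, ((z j).re * (w j).re + (z j).im * (w j).im) := by
  simp only [PiLp.inner_apply, Complex.inner]
  refine Finset.sum_congr rfl fun j _ => ?_
  simp
  ring

theorem omega_eq_inner (z w : C3) :
    omega z w = inner ℝ (WithLp.toLp 2 fun j => Complex.I * z j : C3) w := by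
  rw [inner_eq_sum, omega]
  refine Finset.sum_congr rfl fun j _ => ?_
  simp
  ring

theorem omega_equivariantMap (α : ℝ) (z w : ℝ → C3) (p : ℝ × ℝ) :
    omega (equivariantMap α z p) (equivariantMap α w p) = omega (z p.2) (w p.2) := by
  rw [omega_eq_inner, omega_eq_inner,
    ← inner_equivariantMap α (fun t => WithLp.toLp 2 fun j => Complex.I * z t j) w p]
  congr 1
  ext j
  simp [equivariantMap]
  ring

theorem omega_add_smul (z w w' : C3) (a b : ℝ) :
    omega z (a • w + b • w') = a * omega z w + b * omega z w' := by
  simp only [omega_eq_inner, inner_add_right, inner_smul_right]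

theorem omega_weightAct (α : ℝ) (z : ℝ → C3) (t : ℝ) :
    omega (z t) (weightAct α z t) = ∑ j, weight α j * ‖z t j‖ ^ 2 := by
  rw [omega]
  refine Finset.sum_congr rfl fun j _ => ?_
  rw [← Complex.normSq_eq_norm_sq, Complex.normSq_apply]
  simp [weightAct]
  ring

/-- A conformal parametrisation with `∂_s² u + ∂_t² u` proportional to `u` has zero mean
curvature. -/
theorem meanCurvature_eq_zero {u : ℝ × ℝ → C3} {x : ℝ × ℝ} {E C : ℝ} (hE : E ≠ 0)
    (h00 : inner ℝ (partialDeriv 0 u x) (partialDeriv 0 u x) = E)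
    (h11 : inner ℝ (partialDeriv 1 u x) (partialDeriv 1 u x) = E)
    (h01 : inner ℝ (partialDeriv 0 u x) (partialDeriv 1 u x) = (0 : ℝ))
    (hL : partialDeriv 0 (partialDeriv 0 u) x + partialDeriv 1 (partialDeriv 1 u) x = C • u x) :
    meanCurvature u x = 0 := by
  have h10 : inner ℝ (partialDeriv 1 u x) (partialDeriv 0 u x) = (0 : ℝ) := by
    rw [real_inner_comm, h01]
  have hF : firstForm u x = E • (1 : Matrix (Fin 2) (Fin 2) ℝ) := by
    rw [real_inner_self_eq_norm_sq] at h00 h11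
    ext i j
    fin_cases i <;> fin_cases j <;> simp [firstForm, h00, h01, h10, h11]
  have hI : (firstForm u x)⁻¹ = E⁻¹ • (1 : Matrix (Fin 2) (Fin 2) ℝ) := by
    apply Matrix.inv_eq_right_inv
    rw [hF]
    simp [smul_smul, hE]
  -- The trace of the second fundamental form is the normal projection of `u_ss + u_tt = C u`, and
  -- `u` lies in the space that is projected out.
  have hP : secondForm u x 0 0 + secondForm u x 1 1 = 0 := by
    rw [secondForm, secondForm, ← map_add, hL, map_smul]
    have : u x ∈ tangentCone u x := Submodule.subset_span (by simp)
    rw [Submodule.starProjection_orthogonal_apply_eq_zero this, smul_zero]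
  rw [meanCurvature, hI]
  simp only [Fin.sum_univ_two, Matrix.smul_apply, smul_eq_mul]
  simp [← smul_add, hP]

/-- The hypotheses are first integrals of the profile: `hspeed` and `hconf` give conformality,
`hweight` and `hleg` the Legendrian condition in the directions `s` and `t`, `hpos` nondegeneracy,
and `hneumann` minimality. -/
theorem isMinimalLegendrianImmersion_equivariantMap {α : ℝ} {z z' z'' : ℝ → C3} {C : ℝ → ℝ}
    (hsmooth : ContDiff ℝ ∞ z)
    (hz : ∀ t, HasDerivAt z (z' t) t) (hz' : ∀ t, HasDerivAt z' (z'' t) t)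
    (hsphere : ∀ t, ∑ j, ‖z t j‖ ^ 2 = 1)
    (hweight : ∀ t, ∑ j, weight α j * ‖z t j‖ ^ 2 = 0)
    (hpos : ∀ t, 0 < ∑ j, weight α j ^ 2 * ‖z t j‖ ^ 2)
    (hspeed : ∀ t, ∑ j, ‖z' t j‖ ^ 2 = ∑ j, weight α j ^ 2 * ‖z t j‖ ^ 2)
    (hleg : ∀ t, omega (z t) (z' t) = 0)
    (hconf : ∀ t, ∑ j, weight α j * (starRingEnd ℂ (z t j) * z' t j).im = 0)
    (hneumann : ∀ t j, z'' t j - (weight α j ^ 2 : ℝ) * z t j = -(C t : ℂ) * z t j) :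
    IsMinimalLegendrianImmersion (equivariantMap α z) := by
  have hnorm : ∀ w : C3, inner ℝ w w = ∑ j, ‖w j‖ ^ 2 := fun w => by
    rw [real_inner_self_eq_norm_sq, EuclideanSpace.norm_sq_eq]
  have h00 : ∀ p : ℝ × ℝ, inner ℝ (equivariantMap α (weightAct α z) p)
      (equivariantMap α (weightAct α z) p) = ∑ j, weight α j ^ 2 * ‖z p.2 j‖ ^ 2 := fun p => by
    rw [inner_equivariantMap, hnorm]
    refine Finset.sum_congr rfl fun j _ => ?_
    simp [weightAct, mul_pow]
  have h11 : ∀ p : ℝ × ℝ, inner ℝ (equivariantMap α z' p)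
      (equivariantMap α z' p) = ∑ j, weight α j ^ 2 * ‖z p.2 j‖ ^ 2 := fun p => by
    rw [inner_equivariantMap, hnorm, hspeed]
  have h01 : ∀ p : ℝ × ℝ, inner ℝ (equivariantMap α (weightAct α z) p)
      (equivariantMap α z' p) = (0 : ℝ) := fun p => by
    rw [inner_equivariantMap, inner_eq_sum, ← hconf p.2]
    refine Finset.sum_congr rfl fun j _ => ?_
    simp [weightAct]
    ring
  refine ⟨contDiff_equivariantMap α hsmooth, fun x => ?_, fun x => ?_, fun x v => ?_, fun x => ?_⟩
  · rw [mem_sphere_zero_iff_norm, norm_equivariantMap]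
    have := hsphere x.2
    rw [← EuclideanSpace.norm_sq_eq] at this
    exact (pow_eq_one_iff_of_nonneg (norm_nonneg _) two_ne_zero).1 this
  · rw [injective_iff_map_eq_zero]
    intro v hv
    rw [fderiv_equivariantMap α hz] at hv
    have h0 := congrArg (fun w => (inner ℝ (equivariantMap α (weightAct α z) x) w : ℝ)) hv
    have h1 := congrArg (fun w => (inner ℝ (equivariantMap α z' x) w : ℝ)) hv
    simp only [inner_add_right, inner_smul_right, h00, h01, h11, inner_zero_right] at h0 h1
    rw [real_inner_comm, h01] at h1
    have := (hpos x.2).ne'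
    simp only [mul_zero, add_zero, zero_add, mul_eq_zero, this, or_false] at h0 h1
    exact Prod.ext h0 h1
  · rw [fderiv_equivariantMap α hz, omega_add_smul, omega_equivariantMap, omega_equivariantMap,
      omega_weightAct, hweight, hleg]
    simp
  · refine meanCurvature_eq_zero (E := ∑ j, weight α j ^ 2 * ‖z x.2 j‖ ^ 2) (C := -C x.2)
      (hpos x.2).ne' ?_ ?_ ?_ ?_
    · rw [partialDeriv_zero_equivariantMap α hz, h00]
    · rw [partialDeriv_one_equivariantMap α hz, h11]
    · rw [partialDeriv_one_equivariantMap α hz, partialDeriv_zero_equivariantMap α hz, h01]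
    · rw [partialDeriv_one_equivariantMap α hz, partialDeriv_zero_equivariantMap α hz,
        partialDeriv_zero_equivariantMap α (hasDerivAt_weightAct α hz),
        partialDeriv_one_equivariantMap α hz']
      ext j
      have := hneumann x.2 j
      simp [equivariantMap, weightAct] at this ⊢
      linear_combination (Complex.exp (Complex.I * (weight α j * x.1))) * this +
        (Complex.exp (Complex.I * (weight α j * x.1))) * weight α j ^ 2 * z x.2 j * Complex.I_sq

/-! ### Tori -/

theorem exists_basis_rectangle {P T : ℝ} (hP : P ≠ 0) (hT : T ≠ 0) :
    ∃ b : Module.Basis (Fin 2) ℝ (ℝ × ℝ), b 0 = (P, 0) ∧ b 1 = (0, T) := by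
  have hli : LinearIndependent ℝ ![((P, 0) : ℝ × ℝ), (0, T)] := by
    rw [LinearIndependent.pair_iff]
    intro s t h
    simpa [hP, hT] using h
  refine ⟨basisOfLinearIndependentOfCardEqFinrank hli (by simp), ?_, ?_⟩ <;> simp

theorem givesMinimalLegendrianTorus_of_periodic {u : ℝ × ℝ → C3} {P T : ℝ}
    (hu : IsMinimalLegendrianImmersion u) (hP : P ≠ 0) (hT : T ≠ 0)
    (hs : ∀ s t, u (s + P, t) = u (s, t)) (ht : ∀ s t, u (s, t + T) = u (s, t)) :
    GivesMinimalLegendrianTorus u := by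
  obtain ⟨b, h0, h1⟩ := exists_basis_rectangle hP hT
  have hper : IsPeriodicWith b u := by
    intro v hv
    induction hv using Submodule.span_induction with
    | mem v hv =>
      obtain ⟨i, rfl⟩ := hv
      rintro ⟨s, t⟩
      fin_cases i
      · simpa [h0] using hs s t
      · simpa [h1] using ht s t
    | zero => simp
    | add v w _ _ hv hw =>
      intro x
      rw [← add_assoc, hw, hv]
    | smul n v _ hv =>
      have hp : Function.Periodic u v := hv
      exact hp.zsmul n
  -- Any choice of representatives gives the descended map, since two of them differ by a period.
  refine ⟨b, hper, fun q => ⟨u (Quotient.out q), hu.mem_sphere _⟩, ?_⟩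
  have hf : ∀ x, u (Quotient.out (Submodule.Quotient.mk x : PlaneTorus b)) = u x := by
    intro x
    set y := Quotient.out (Submodule.Quotient.mk x : PlaneTorus b) with hy
    have : (Submodule.Quotient.mk y : PlaneTorus b) = Submodule.Quotient.mk x :=
      Quotient.out_eq _
    rw [Submodule.Quotient.eq] at this
    have h2 := hper _ this x
    rwa [add_sub_cancel] at h2
  refine ⟨hf, ?_⟩
  show IsMinimalLegendrianImmersion fun x => u (Quotient.out (Submodule.Quotient.mk x : PlaneTorus b))
  rwa [show (fun x => u (Quotient.out (Submodule.Quotient.mk x : PlaneTorus b))) = u from funext hf]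

/-! ### Inverting the primitive of a positive periodic function -/

/-- The primitive of `h` that vanishes at `0`. -/
def primitive (h : ℝ → ℝ) (φ : ℝ) : ℝ := ∫ x in (0 : ℝ)..φ, h x

section primitive

variable {h : ℝ → ℝ} {L : ℝ}

theorem hasDerivAt_primitive (hc : Continuous h) (φ : ℝ) :
    HasDerivAt (primitive h) (h φ) φ :=
  (hc.integral_hasStrictDerivAt 0 φ).hasDerivAt

theorem primitive_zero (h : ℝ → ℝ) : primitive h 0 = 0 := by
  simp [primitive]

theorem primitive_add_period (hc : Continuous h) (hper : Function.Periodic h L) (φ : ℝ) :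
    primitive h (φ + L) = primitive h φ + primitive h L := by
  have := hper.intervalIntegral_add_eq_add 0 φ fun a b => hc.intervalIntegrable a b
  simpa [primitive] using this

theorem primitive_add_nat_mul_period (hc : Continuous h) (hper : Function.Periodic h L) (φ : ℝ)
    (n : ℕ) : primitive h (φ + n * L) = primitive h φ + n * primitive h L := by
  induction n with
  | zero => simp
  | succ n ih =>
    rw [Nat.cast_succ, add_mul, one_mul, ← add_assoc, primitive_add_period hc hper, ih]
    ring

theorem primitive_strictMono (hc : Continuous h) (hpos : ∀ x, 0 < h x) :
    StrictMono (primitive h) :=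
  strictMono_of_hasDerivAt_pos (hasDerivAt_primitive hc) hpos

/-- Each period adds the same positive amount, so the primitive tends to `±∞` at both ends. -/
theorem primitive_surjective (hc : Continuous h) (hpos : ∀ x, 0 < h x)
    (hper : Function.Periodic h L) (hL : 0 < L) : Function.Surjective (primitive h) := by
  have hcont : Continuous (primitive h) :=
    continuous_iff_continuousAt.2 fun x => (hasDerivAt_primitive hc x).continuousAt
  exact hcont.surjective
    (hper.tendsto_atTop_intervalIntegral_of_pos' (hc.intervalIntegrable _ _) hpos hL)
    (hper.tendsto_atBot_intervalIntegral_of_pos' (hc.intervalIntegrable _ _) hpos hL)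

theorem primitive_invFun (hc : Continuous h) (hpos : ∀ x, 0 < h x)
    (hper : Function.Periodic h L) (hL : 0 < L) (t : ℝ) :
    primitive h (Function.invFun (primitive h) t) = t :=
  Function.rightInverse_invFun (primitive_surjective hc hpos hper hL) t

theorem invFun_primitive (hc : Continuous h) (hpos : ∀ x, 0 < h x) (φ : ℝ) :
    Function.invFun (primitive h) (primitive h φ) = φ :=
  Function.leftInverse_invFun (primitive_strictMono hc hpos).injective φ

theorem invFun_primitive_zero (hc : Continuous h) (hpos : ∀ x, 0 < h x) :
    Function.invFun (primitive h) 0 = 0 := by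
  simpa only [primitive_zero] using invFun_primitive hc hpos 0

theorem invFun_primitive_add_nat_mul (hc : Continuous h) (hpos : ∀ x, 0 < h x)
    (hper : Function.Periodic h L) (hL : 0 < L) (t : ℝ) (n : ℕ) :
    Function.invFun (primitive h) (t + n * primitive h L) =
      Function.invFun (primitive h) t + n * L := by
  apply (primitive_strictMono hc hpos).injective
  rw [primitive_invFun hc hpos hper hL, primitive_add_nat_mul_period hc hper,
    primitive_invFun hc hpos hper hL]

theorem hasDerivAt_invFun_primitive (hc : Continuous h) (hpos : ∀ x, 0 < h x)
    (hper : Function.Periodic h L) (hL : 0 < L) (t : ℝ) :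
    HasDerivAt (Function.invFun (primitive h)) (h (Function.invFun (primitive h) t))⁻¹ t := by
  -- The inverse is monotone and surjective, hence continuous, as the inverse function rule
  -- requires.
  have hcont : Continuous (Function.invFun (primitive h)) := by
    have hmono : StrictMono (Function.invFun (primitive h)) := by
      intro s t hst
      rw [← (primitive_strictMono hc hpos).lt_iff_lt, primitive_invFun hc hpos hper hL,
        primitive_invFun hc hpos hper hL]
      exact hst
    exact hmono.monotone.continuous_of_surjective fun φ => ⟨_, invFun_primitive hc hpos φ⟩
  exact (hasDerivAt_primitive hc _).of_local_left_inverse hcont.continuousAt (hpos _).ne'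
    (Filter.Eventually.of_forall fun t => primitive_invFun hc hpos hper hL t)

end primitive

/-- A solution of an autonomous smooth equation on the line is smooth. -/
theorem contDiff_of_hasDerivAt_comp {g ψ : ℝ → ℝ} (hg : ContDiff ℝ ∞ g)
    (hψ : ∀ t, HasDerivAt ψ (g (ψ t)) t) : ContDiff ℝ ∞ ψ := by
  have hd : Differentiable ℝ ψ := fun t => (hψ t).differentiableAt
  have hderiv : deriv ψ = g ∘ ψ := funext fun t => (hψ t).deriv
  rw [contDiff_infty]
  intro n
  induction n with
  | zero => exact contDiff_zero.2 hd.continuous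
  | succ n ih =>
    rw [Nat.cast_succ, contDiff_succ_iff_deriv]
    refine ⟨hd, by simp, ?_⟩
    rw [hderiv]
    exact (hg.of_le (by exact_mod_cast le_top)).comp ih

theorem contDiff_of_hasDerivAt {f f' : ℝ → ℝ} (hf' : ContDiff ℝ ∞ f')
    (hf : ∀ t, HasDerivAt f (f' t) t) : ContDiff ℝ ∞ f := by
  rw [contDiff_infty_iff_deriv]
  refine ⟨fun t => (hf t).differentiableAt, ?_⟩
  rwa [show deriv f = f' from funext fun t => (hf t).deriv]

/-! ### Jacobi elliptic functions -/

section jacobi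

variable {k : ℝ}

theorem one_sub_sq_mul_sin_sq_pos (hk : k ^ 2 < 1) (x : ℝ) : 0 < 1 - k ^ 2 * Real.sin x ^ 2 := by
  nlinarith [Real.sin_sq_le_one x, sq_nonneg (Real.sin x), sq_nonneg k]

theorem continuous_ellipticF_integrand (hk : k ^ 2 < 1) :
    Continuous fun x => 1 / √(1 - k ^ 2 * Real.sin x ^ 2) := by
  refine continuous_const.div (by fun_prop) fun x => ?_
  exact (Real.sqrt_pos.2 (one_sub_sq_mul_sin_sq_pos hk x)).ne'

theorem ellipticF_integrand_pos (hk : k ^ 2 < 1) (x : ℝ) :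
    0 < 1 / √(1 - k ^ 2 * Real.sin x ^ 2) :=
  one_div_pos.2 (Real.sqrt_pos.2 (one_sub_sq_mul_sin_sq_pos hk x))

theorem ellipticF_integrand_periodic (k : ℝ) :
    Function.Periodic (fun x => 1 / √(1 - k ^ 2 * Real.sin x ^ 2)) (2 * Real.pi) := fun x => by
  simp

theorem ellipticF_two_pi_pos (hk : k ^ 2 < 1) : 0 < ellipticF k (2 * Real.pi) := by
  have := primitive_strictMono (continuous_ellipticF_integrand hk) (ellipticF_integrand_pos hk)
    Real.two_pi_pos
  rwa [primitive_zero] at this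

/-- `ellipticF k (2 π)` is four times the complete integral, a common period of `sn`, `cn` and `dn`.
-/
theorem jacobiAm_add_ellipticF_two_pi (hk : k ^ 2 < 1) (x : ℝ) :
    jacobiAm k (x + ellipticF k (2 * Real.pi)) = jacobiAm k x + 2 * Real.pi := by
  have := invFun_primitive_add_nat_mul (continuous_ellipticF_integrand hk)
    (ellipticF_integrand_pos hk) (ellipticF_integrand_periodic k) Real.two_pi_pos x 1
  rwa [Nat.cast_one, one_mul, one_mul] at this

theorem hasDerivAt_jacobiAm (hk : k ^ 2 < 1) (x : ℝ) :
    HasDerivAt (jacobiAm k) (jacobiDn k x) x := by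
  have := hasDerivAt_invFun_primitive (continuous_ellipticF_integrand hk)
    (ellipticF_integrand_pos hk) (ellipticF_integrand_periodic k) Real.two_pi_pos x
  rwa [one_div, inv_inv] at this

theorem jacobiDn_sq (hk : k ^ 2 < 1) (x : ℝ) : jacobiDn k x ^ 2 = 1 - k ^ 2 * jacobiSn k x ^ 2 :=
  Real.sq_sqrt (one_sub_sq_mul_sin_sq_pos hk _).le

theorem jacobiDn_pos (hk : k ^ 2 < 1) (x : ℝ) : 0 < jacobiDn k x :=
  Real.sqrt_pos.2 (one_sub_sq_mul_sin_sq_pos hk _)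

theorem jacobiCn_sq (k x : ℝ) : jacobiCn k x ^ 2 = 1 - jacobiSn k x ^ 2 :=
  Real.cos_sq' _

theorem hasDerivAt_jacobiSn (hk : k ^ 2 < 1) (x : ℝ) :
    HasDerivAt (jacobiSn k) (jacobiCn k x * jacobiDn k x) x :=
  (hasDerivAt_jacobiAm hk x).sin

theorem hasDerivAt_jacobiCn (hk : k ^ 2 < 1) (x : ℝ) :
    HasDerivAt (jacobiCn k) (-(jacobiSn k x * jacobiDn k x)) x := by
  have := (hasDerivAt_jacobiAm hk x).cos
  rwa [neg_mul] at this

theorem hasDerivAt_jacobiDn (hk : k ^ 2 < 1) (x : ℝ) :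
    HasDerivAt (jacobiDn k) (-(k ^ 2 * jacobiSn k x * jacobiCn k x)) x := by
  have h := ((((hasDerivAt_jacobiSn hk x).pow 2).const_mul (k ^ 2)).const_sub 1).sqrt
    (one_sub_sq_mul_sin_sq_pos hk _).ne'
  refine h.congr_deriv ?_
  change _ / (2 * jacobiDn k x) = _
  have := (jacobiDn_pos hk x).ne'
  field_simp
  simp
  ring

theorem contDiff_jacobiAm (hk : k ^ 2 < 1) : ContDiff ℝ ∞ (jacobiAm k) := by
  refine contDiff_of_hasDerivAt_comp (g := fun φ => √(1 - k ^ 2 * Real.sin φ ^ 2)) ?_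
    (hasDerivAt_jacobiAm hk)
  exact ContDiff.sqrt (contDiff_const.sub (contDiff_const.mul (Real.contDiff_sin.pow 2)))
    fun x => (one_sub_sq_mul_sin_sq_pos hk x).ne'

theorem contDiff_jacobiSn (hk : k ^ 2 < 1) : ContDiff ℝ ∞ (jacobiSn k) :=
  (contDiff_jacobiAm hk).sin

theorem contDiff_jacobiCn (hk : k ^ 2 < 1) : ContDiff ℝ ∞ (jacobiCn k) :=
  (contDiff_jacobiAm hk).cos

theorem contDiff_jacobiDn (hk : k ^ 2 < 1) : ContDiff ℝ ∞ (jacobiDn k) :=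
  ContDiff.sqrt (contDiff_const.sub (contDiff_const.mul ((contDiff_jacobiSn hk).pow 2)))
    fun _ => (one_sub_sq_mul_sin_sq_pos hk _).ne'

end jacobi

/-! ### The family with `J = 0` -/

theorem omega_eq_sum_im (z w : C3) : omega z w = ∑ j, (starRingEnd ℂ (z j) * w j).im := by
  rw [omega]
  refine Finset.sum_congr rfl fun j _ => ?_
  simp
  ring

theorem star_mul_mul_of_norm_eq_one {c : ℂ} (hc : ‖c‖ = 1) (a b : ℂ) :
    starRingEnd ℂ (c * a) * (c * b) = starRingEnd ℂ a * b := by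
  have h : starRingEnd ℂ c * c = 1 := by
    rw [mul_comm, Complex.mul_conj, Complex.normSq_eq_norm_sq, hc]
    simp
  rw [map_mul]
  linear_combination (starRingEnd ℂ a * b) * h

theorem star_ofReal_mul_ofReal_im (a b : ℝ) : (starRingEnd ℂ (a : ℂ) * (b : ℂ)).im = 0 := by
  simp

/-- The curve with coordinates `c j * f j t`, for constant phases `c j`. -/
def phaseCurve (c : Fin 3 → ℂ) (f : Fin 3 → ℝ → ℝ) : ℝ → C3 :=
  fun t => WithLp.toLp 2 fun j => c j * (f j t : ℂ)

theorem hasDerivAt_phaseCurve (c : Fin 3 → ℂ) {f f' : Fin 3 → ℝ → ℝ} {t : ℝ}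
    (h : ∀ j, HasDerivAt (f j) (f' j t) t) :
    HasDerivAt (phaseCurve c f) (phaseCurve c f' t) t := by
  rw [hasDerivAt_euclidean]
  intro j
  exact ((h j).ofReal_comp).const_mul (c j)

theorem contDiff_phaseCurve (c : Fin 3 → ℂ) {f : Fin 3 → ℝ → ℝ} (h : ∀ j, ContDiff ℝ ∞ (f j)) :
    ContDiff ℝ ∞ (phaseCurve c f) := by
  rw [contDiff_piLp]
  intro j
  exact contDiff_const.mul (Complex.ofRealCLM.contDiff.comp (h j))

theorem norm_phaseCurve_sq {c : Fin 3 → ℂ} (hc : ∀ j, ‖c j‖ = 1) (f : Fin 3 → ℝ → ℝ) (t : ℝ)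
    (j : Fin 3) : ‖phaseCurve c f t j‖ ^ 2 = f j t ^ 2 := by
  simp [phaseCurve, hc]

theorem isMinimalLegendrianImmersion_phaseCurve {α : ℝ} {c : Fin 3 → ℂ} (hc : ∀ j, ‖c j‖ = 1)
    {f f' f'' : Fin 3 → ℝ → ℝ} {C : ℝ → ℝ} (hsmooth : ∀ j, ContDiff ℝ ∞ (f j))
    (hf : ∀ j t, HasDerivAt (f j) (f' j t) t) (hf' : ∀ j t, HasDerivAt (f' j) (f'' j t) t)
    (hsphere : ∀ t, ∑ j, f j t ^ 2 = 1)
    (hweight : ∀ t, ∑ j, weight α j * f j t ^ 2 = 0)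
    (hpos : ∀ t, 0 < ∑ j, weight α j ^ 2 * f j t ^ 2)
    (hspeed : ∀ t, ∑ j, f' j t ^ 2 = ∑ j, weight α j ^ 2 * f j t ^ 2)
    (hneumann : ∀ t j, f'' j t - weight α j ^ 2 * f j t = -C t * f j t) :
    IsMinimalLegendrianImmersion (equivariantMap α (phaseCurve c f)) := by
  have him : ∀ t j, (starRingEnd ℂ (phaseCurve c f t j) * phaseCurve c f' t j).im = 0 :=
    fun t j => by
      simp only [phaseCurve]
      rw [star_mul_mul_of_norm_eq_one (hc j), star_ofReal_mul_ofReal_im]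
  refine isMinimalLegendrianImmersion_equivariantMap (z' := phaseCurve c f')
    (z'' := phaseCurve c f'') (C := C) (contDiff_phaseCurve c hsmooth)
    (fun t => hasDerivAt_phaseCurve c fun j => hf j t)
    (fun t => hasDerivAt_phaseCurve c fun j => hf' j t) ?_ ?_ ?_ ?_ ?_ ?_ ?_
  · simpa only [norm_phaseCurve_sq hc] using hsphere
  · simpa only [norm_phaseCurve_sq hc] using hweight
  · simpa only [norm_phaseCurve_sq hc] using hpos
  · simpa only [norm_phaseCurve_sq hc] using hspeed
  · intro t
    rw [omega_eq_sum_im]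
    exact Finset.sum_eq_zero fun j _ => him t j
  · intro t
    exact Finset.sum_eq_zero fun j _ => by rw [him, mul_zero]
  · intro t j
    simp only [phaseCurve]
    have := congrArg (fun x : ℝ => c j * (x : ℂ)) (hneumann t j)
    push_cast at this ⊢
    linear_combination this

/-- The real factors of the coordinates of `profileZero`. -/
def profileZeroRadial (α : ℝ) : Fin 3 → ℝ → ℝ :=
  ![fun t => √((1 + α) / (2 + α)) * jacobiCn (modulusZero α) (rateZero α * t),
    fun t => √((1 + α) / (1 + 2 * α)) * jacobiSn (modulusZero α) (rateZero α * t),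
    fun t => √(1 / (2 + α)) * jacobiDn (modulusZero α) (rateZero α * t)]

/-- The constant phases of the coordinates of `profileZero`. -/
def profileZeroPhase (θ : ℝ) : Fin 3 → ℂ :=
  ![Complex.exp (-(Complex.I * (θ + Real.pi / 2 : ℝ))), 1, 1]

theorem profileZero_eq_phaseCurve (θ α : ℝ) :
    profileZero θ α = phaseCurve (profileZeroPhase θ) (profileZeroRadial α) := by
  ext t j
  fin_cases j <;> simp [profileZero, phaseCurve, profileZeroPhase, profileZeroRadial]

theorem norm_profileZeroPhase (θ : ℝ) (j : Fin 3) : ‖profileZeroPhase θ j‖ = 1 := by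
  fin_cases j
  · simp [profileZeroPhase, Complex.norm_exp]
  · simp [profileZeroPhase]
  · simp [profileZeroPhase]

section

variable {α : ℝ}

theorem modulusZero_sq (hα : α ∈ Set.Ioc (0 : ℝ) 1) :
    modulusZero α ^ 2 = (1 - α ^ 2) / (1 + 2 * α) := by
  obtain ⟨h0, h1⟩ := hα
  exact Real.sq_sqrt (div_nonneg (by nlinarith) (by linarith))

theorem modulusZero_sq_lt_one (hα : α ∈ Set.Ioc (0 : ℝ) 1) : modulusZero α ^ 2 < 1 := by
  rw [modulusZero_sq hα, div_lt_one (by linarith [hα.1])]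
  nlinarith [hα.1]

theorem rateZero_sq (hα : α ∈ Set.Ioc (0 : ℝ) 1) : rateZero α ^ 2 = 1 + 2 * α :=
  Real.sq_sqrt (by linarith [hα.1])

theorem rateZero_pos (hα : α ∈ Set.Ioc (0 : ℝ) 1) : 0 < rateZero α :=
  Real.sqrt_pos.2 (by linarith [hα.1])

theorem hasDerivAt_comp_mul_left {f : ℝ → ℝ} {f' r t : ℝ} (hf : HasDerivAt f f' (r * t)) :
    HasDerivAt (fun t => f (r * t)) (r * f') t := by
  have h : HasDerivAt (fun t => r * t) r t := by
    simpa using (hasDerivAt_id t).const_mul r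
  have := hf.comp t h
  rwa [mul_comm] at this

theorem isMinimalLegendrianImmersion_profileZero (θ : ℝ) (hα : α ∈ Set.Ioc (0 : ℝ) 1) :
    IsMinimalLegendrianImmersion (equivariantMap α (profileZero θ α)) := by
  have hk := modulusZero_sq_lt_one hα
  have hr2 := rateZero_sq hα
  have hk2 := modulusZero_sq hα
  obtain ⟨h0, h1⟩ := hα
  have ha2 : √((1 + α) / (2 + α)) ^ 2 = (1 + α) / (2 + α) :=
    Real.sq_sqrt (div_nonneg (by linarith) (by linarith))
  have hb2 : √((1 + α) / (1 + 2 * α)) ^ 2 = (1 + α) / (1 + 2 * α) :=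
    Real.sq_sqrt (div_nonneg (by linarith) (by linarith))
  have hc2 : √(1 / (2 + α)) ^ 2 = 1 / (2 + α) :=
    Real.sq_sqrt (div_nonneg (by linarith) (by linarith))
  have hsm : ∀ {f : ℝ → ℝ} (a : ℝ), ContDiff ℝ ∞ f →
      ContDiff ℝ ∞ fun t => a * f (rateZero α * t) := fun a hf =>
    contDiff_const.mul (hf.comp (contDiff_const.mul contDiff_id))
  have hsphere : ∀ t, ∑ j, profileZeroRadial α j t ^ 2 = 1 := by
    intro t
    simp only [Fin.sum_univ_three, profileZeroRadial, Matrix.cons_val, mul_pow, ha2, hb2, hc2,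
      jacobiDn_sq hk, jacobiCn_sq, hk2]
    field_simp
    ring
  -- `α > 0` matters here: with all weights nonzero, `A z` cannot vanish on the sphere.
  have hcoef : ∀ j, weight α j ≠ 0 := by
    intro j
    fin_cases j
    · simp [weight]
    · simpa [weight] using h0.ne'
    · simp only [weight, Fin.reduceFinMk, Matrix.cons_val]
      linarith
  rw [profileZero_eq_phaseCurve]
  set r := rateZero α
  set k := modulusZero α
  set a := √((1 + α) / (2 + α))
  set b := √((1 + α) / (1 + 2 * α))
  set c := √(1 / (2 + α))
  have hf0 : ∀ t, profileZeroRadial α 0 t = a * jacobiCn k (r * t) := fun t => rfl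
  have hf1 : ∀ t, profileZeroRadial α 1 t = b * jacobiSn k (r * t) := fun t => rfl
  have hf2 : ∀ t, profileZeroRadial α 2 t = c * jacobiDn k (r * t) := fun t => rfl
  refine isMinimalLegendrianImmersion_phaseCurve (norm_profileZeroPhase θ)
    (f' := ![fun t => a * (r * -(jacobiSn k (r * t) * jacobiDn k (r * t))),
      fun t => b * (r * (jacobiCn k (r * t) * jacobiDn k (r * t))),
      fun t => c * (r * -(k ^ 2 * jacobiSn k (r * t) * jacobiCn k (r * t)))])
    (f'' := ![fun t => -(r ^ 2 * (1 - 2 * k ^ 2 * jacobiSn k (r * t) ^ 2)) *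
        (a * jacobiCn k (r * t)),
      fun t => -(r ^ 2 * (1 + k ^ 2 - 2 * k ^ 2 * jacobiSn k (r * t) ^ 2)) *
        (b * jacobiSn k (r * t)),
      fun t => -(r ^ 2 * k ^ 2 * (1 - 2 * jacobiSn k (r * t) ^ 2)) *
        (c * jacobiDn k (r * t))])
    -- This is `|Az|² + |z'|² = 2 |Az|²`, with `cn²` and `dn²` expressed through `sn²`.
    (C := fun t => 2 + 2 * α - 2 * (1 - α ^ 2) * jacobiSn k (r * t) ^ 2) ?_ ?_ ?_ hsphere
    ?_ ?_ ?_ ?_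
  · intro j
    fin_cases j
    · exact hsm _ (contDiff_jacobiCn hk)
    · exact hsm _ (contDiff_jacobiSn hk)
    · exact hsm _ (contDiff_jacobiDn hk)
  · intro j t
    fin_cases j
    · exact (hasDerivAt_comp_mul_left (hasDerivAt_jacobiCn hk (r * t))).const_mul a
    · exact (hasDerivAt_comp_mul_left (hasDerivAt_jacobiSn hk (r * t))).const_mul b
    · exact (hasDerivAt_comp_mul_left (hasDerivAt_jacobiDn hk (r * t))).const_mul c
  · intro j t
    have hs := hasDerivAt_comp_mul_left (hasDerivAt_jacobiSn hk (r * t))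
    have hc := hasDerivAt_comp_mul_left (hasDerivAt_jacobiCn hk (r * t))
    have hd := hasDerivAt_comp_mul_left (hasDerivAt_jacobiDn hk (r * t))
    have hc' := jacobiCn_sq k (r * t)
    have hd' := jacobiDn_sq hk (r * t)
    fin_cases j
    · refine (((hs.mul hd).neg.const_mul r).const_mul a).congr_deriv ?_
      simp only [Fin.zero_eta, Matrix.cons_val]
      linear_combination -(a * r ^ 2 * jacobiCn k (r * t)) * hd'
    · refine (((hc.mul hd).const_mul r).const_mul b).congr_deriv ?_
      simp only [Fin.mk_one, Matrix.cons_val]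
      linear_combination -(b * r ^ 2 * jacobiSn k (r * t)) * hd' -
        (b * r ^ 2 * k ^ 2 * jacobiSn k (r * t)) * hc'
    · refine (((((hs.const_mul (k ^ 2)).mul hc).neg).const_mul r).const_mul c).congr_deriv ?_
      simp only [Fin.reduceFinMk, Matrix.cons_val]
      linear_combination -(c * r ^ 2 * k ^ 2 * jacobiDn k (r * t)) * hc'
  · intro t
    simp only [Fin.sum_univ_three, hf0, hf1, hf2, weight, Matrix.cons_val, mul_pow, ha2, hb2,
      hc2, jacobiDn_sq hk, jacobiCn_sq, hk2]
    field_simp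
    ring
  · intro t
    have hne : ∃ j, profileZeroRadial α j t ≠ 0 := by
      by_contra! h
      simpa [h] using hsphere t
    obtain ⟨j, hj⟩ := hne
    refine Finset.sum_pos' (fun i _ => by positivity) ⟨j, Finset.mem_univ j, ?_⟩
    have := hcoef j
    positivity
  · intro t
    simp only [Fin.sum_univ_three, hf0, hf1, hf2, weight, Matrix.cons_val, mul_pow, neg_sq,
      ha2, hb2, hc2, jacobiDn_sq hk, jacobiCn_sq, hr2, hk2]
    field_simp
    ring
  · have hrk : r ^ 2 * k ^ 2 = 1 - α ^ 2 := by
      rw [hr2, hk2]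
      field_simp
    intro t j
    fin_cases j
    · simp only [Fin.zero_eta, hf0, weight, Matrix.cons_val]
      linear_combination (2 * jacobiSn k (r * t) ^ 2 * (a * jacobiCn k (r * t))) * hrk -
        (a * jacobiCn k (r * t)) * hr2
    · simp only [Fin.mk_one, hf1, weight, Matrix.cons_val]
      linear_combination ((2 * jacobiSn k (r * t) ^ 2 - 1) * (b * jacobiSn k (r * t))) * hrk -
        (b * jacobiSn k (r * t)) * hr2
    · simp only [Fin.reduceFinMk, hf2, weight, Matrix.cons_val]
      linear_combination ((2 * jacobiSn k (r * t) ^ 2 - 1) * (c * jacobiDn k (r * t))) * hrk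

theorem profileZero_periodic (θ : ℝ) (hα : α ∈ Set.Ioc (0 : ℝ) 1) (t : ℝ) :
    profileZero θ α (t + ellipticF (modulusZero α) (2 * Real.pi) / rateZero α) =
      profileZero θ α t := by
  have h : rateZero α * (t + ellipticF (modulusZero α) (2 * Real.pi) / rateZero α) =
      rateZero α * t + ellipticF (modulusZero α) (2 * Real.pi) := by
    have := (rateZero_pos hα).ne'
    field_simp
  simp only [profileZero, jacobiDn, jacobiCn, jacobiSn, h,
    jacobiAm_add_ellipticF_two_pi (modulusZero_sq_lt_one hα), Real.sin_add_two_pi,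
    Real.cos_add_two_pi]

end

theorem equivariantMap_add_fst {α P : ℝ} {n : Fin 3 → ℤ}
    (hn : ∀ j, weight α j * P = n j * (2 * Real.pi)) (z : ℝ → C3) (s t : ℝ) :
    equivariantMap α z (s + P, t) = equivariantMap α z (s, t) := by
  ext j
  simp only [equivariantMap]
  congr 1
  rw [mul_add, hn, Complex.exp_eq_exp_iff_exists_int]
  refine ⟨n j, ?_⟩
  push_cast
  ring

theorem givesMinimalLegendrianTorus_profileZero (θ : ℝ) {α : ℝ} (hα : α ∈ Set.Ioc (0 : ℝ) 1)
    {q : ℚ} (hq : (q : ℝ) = α) :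
    GivesMinimalLegendrianTorus (equivariantMap α (profileZero θ α)) := by
  have hden : (q.den : ℝ) ≠ 0 := by exact_mod_cast q.den_nz
  have hqα : α * q.den = q.num := by
    rw [← hq]
    exact_mod_cast Rat.mul_den_eq_num q
  -- The denominator of `α` clears all three weights `1`, `α`, `-1 - α` to integers.
  refine givesMinimalLegendrianTorus_of_periodic (P := q.den * (2 * Real.pi))
    (T := ellipticF (modulusZero α) (2 * Real.pi) / rateZero α)
    (isMinimalLegendrianImmersion_profileZero θ hα)
    (mul_ne_zero hden Real.two_pi_pos.ne')
    (div_pos (ellipticF_two_pi_pos (modulusZero_sq_lt_one hα)) (rateZero_pos hα)).ne' ?_ ?_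
  · refine equivariantMap_add_fst (n := ![q.den, q.num, -q.den - q.num]) (fun j => ?_) _
    fin_cases j
    · simp [weight]
    · simp [weight, ← hqα]
      ring
    · simp [weight, ← hqα]
      ring
  · intro s t
    simp only [equivariantMap, profileZero_periodic θ hα]

/-! ### Curves in polar coordinates -/

/-- The curve in `ℂ` with squared radius `ρ` and angle `ϑ`. -/
def polarCurve (ρ ϑ : ℝ → ℝ) (t : ℝ) : ℂ := (√(ρ t) : ℂ) * Complex.exp (Complex.I * ϑ t)

/-- The logarithmic derivative of a curve in polar coordinates with squared radius `ρ`, with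
`ρ' = σ`, and angular momentum `κ`. -/
def polarLogDeriv (ρ σ κ : ℝ) : ℂ := ((σ / 2 : ℝ) + κ * Complex.I) / ρ

section polar

variable {ρ σ ϑ : ℝ → ℝ} {κ τ t : ℝ}

theorem hasDerivAt_polarCurve (hρ : 0 < ρ t) (h1 : HasDerivAt ρ (σ t) t)
    (h2 : HasDerivAt ϑ (κ / ρ t) t) :
    HasDerivAt (polarCurve ρ ϑ) (polarCurve ρ ϑ t * polarLogDeriv (ρ t) (σ t) κ) t := by
  have h3 := (h1.sqrt hρ.ne').ofReal_comp
  have h4 := (h2.ofReal_comp.const_mul Complex.I).cexp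
  refine (h3.mul h4).congr_deriv ?_
  have hs : (√(ρ t) : ℂ) ≠ 0 := by exact_mod_cast (Real.sqrt_pos.2 hρ).ne'
  have hr : (ρ t : ℂ) = (√(ρ t) : ℂ) ^ 2 := by exact_mod_cast (Real.sq_sqrt hρ.le).symm
  simp only [polarCurve, polarLogDeriv]
  push_cast
  rw [hr]
  field_simp

/-- With `L = z'/z`, one has `z'' = (L' + L²) z`. The imaginary parts of `L'` and `L²` cancel
because the angular momentum `κ` is constant, leaving a real factor. -/
theorem hasDerivAt_polarCurve_mul_polarLogDeriv (hρ : 0 < ρ t) (h1 : HasDerivAt ρ (σ t) t)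
    (h2 : HasDerivAt ϑ (κ / ρ t) t) (h3 : HasDerivAt σ τ t) :
    HasDerivAt (fun t => polarCurve ρ ϑ t * polarLogDeriv (ρ t) (σ t) κ)
      (((ρ t * τ / 2 - σ t ^ 2 / 4 - κ ^ 2) / ρ t ^ 2 : ℝ) * polarCurve ρ ϑ t) t := by
  have hr : (ρ t : ℂ) ≠ 0 := by exact_mod_cast hρ.ne'
  have h4 : HasDerivAt (fun t => polarLogDeriv (ρ t) (σ t) κ)
      ((((τ / 2 : ℝ) : ℂ) * ρ t - ((σ t / 2 : ℝ) + κ * Complex.I) * σ t) / (ρ t : ℂ) ^ 2) t :=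
    (((h3.div_const 2).ofReal_comp).add_const _).div h1.ofReal_comp hr
  refine ((hasDerivAt_polarCurve hρ h1 h2).mul h4).congr_deriv ?_
  simp only [polarLogDeriv]
  push_cast
  field_simp
  ring_nf
  simp only [Complex.I_sq]
  ring

theorem norm_polarCurve_sq (hρ : 0 ≤ ρ t) : ‖polarCurve ρ ϑ t‖ ^ 2 = ρ t := by
  rw [polarCurve, norm_mul, mul_comm Complex.I, Complex.norm_exp_ofReal_mul_I, mul_one,
    Complex.norm_real, Real.norm_eq_abs, sq_abs, Real.sq_sqrt hρ]

theorem norm_polarLogDeriv_sq (ρ σ κ : ℝ) :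
    ‖polarLogDeriv ρ σ κ‖ ^ 2 = (σ ^ 2 / 4 + κ ^ 2) / ρ ^ 2 := by
  rw [polarLogDeriv, norm_div, div_pow, ← Complex.normSq_eq_norm_sq, Complex.normSq_add_mul_I,
    Complex.norm_real, Real.norm_eq_abs, sq_abs]
  ring

theorem im_star_polarCurve_mul (hρ : 0 < ρ t) (s : ℝ) :
    (starRingEnd ℂ (polarCurve ρ ϑ t) * (polarCurve ρ ϑ t * polarLogDeriv (ρ t) s κ)).im = κ := by
  have h : starRingEnd ℂ (polarCurve ρ ϑ t) * polarCurve ρ ϑ t = (ρ t : ℂ) := by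
    rw [mul_comm, Complex.mul_conj, Complex.normSq_eq_norm_sq, norm_polarCurve_sq hρ.le]
  have hr : (ρ t : ℂ) ≠ 0 := by exact_mod_cast hρ.ne'
  rw [← mul_assoc, h, polarLogDeriv, mul_div_cancel₀ _ hr]
  simp

theorem contDiff_polarCurve (hρ : ∀ t, 0 < ρ t) (h1 : ContDiff ℝ ∞ ρ) (h2 : ContDiff ℝ ∞ ϑ) :
    ContDiff ℝ ∞ (polarCurve ρ ϑ) := by
  have h3 : ContDiff ℝ ∞ fun t => √(ρ t) := h1.sqrt fun t => (hρ t).ne'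
  have h4 : ContDiff ℝ ∞ fun t => (√(ρ t) : ℂ) := Complex.ofRealCLM.contDiff.comp h3
  have h5 : ContDiff ℝ ∞ fun t => (ϑ t : ℂ) := Complex.ofRealCLM.contDiff.comp h2
  exact h4.mul (contDiff_const.mul h5).cexp

end polar

/-! ### The family with `α = 0` -/

/-- The motion of `x = |z₂|²`, with velocity `V` and with the angle `ϑ` of `z₂`, along the solution
of the Neumann system with `α = 0`. -/
structure IsRadialMotion (J : ℝ) (x V ϑ : ℝ → ℝ) : Prop where
  hasDerivAt_x : ∀ t, HasDerivAt x (V t) t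
  hasDerivAt_V : ∀ t, HasDerivAt V (2 * (1 - x t) * (1 - 3 * x t)) t
  hasDerivAt_angle : ∀ t, HasDerivAt ϑ (2 * J / x t) t
  energy : ∀ t, V t ^ 2 = 4 * (x t * (1 - x t) ^ 2 - 4 * J ^ 2)
  J_pos : 0 < J
  x_pos : ∀ t, 0 < x t
  x_lt_one : ∀ t, x t < 1
  contDiff_x : ContDiff ℝ ∞ x
  V_zero : V 0 = 0
  angle_zero : ϑ 0 = 0
  third_le_x_zero : 1 / 3 ≤ x 0

/-- The squared radii `|z_j|²`. -/
def radial (x : ℝ → ℝ) : Fin 3 → ℝ → ℝ :=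
  ![fun t => (1 - x t) / 2, x, fun t => (1 - x t) / 2]

/-- The derivatives of the squared radii. -/
def radialDeriv (V : ℝ → ℝ) : Fin 3 → ℝ → ℝ :=
  ![fun t => -V t / 2, V, fun t => -V t / 2]

/-- The second derivatives of the squared radii. -/
def radialDerivDeriv (x : ℝ → ℝ) : Fin 3 → ℝ → ℝ :=
  ![fun t => -((1 - x t) * (1 - 3 * x t)), fun t => 2 * (1 - x t) * (1 - 3 * x t),
    fun t => -((1 - x t) * (1 - 3 * x t))]

/-- The angle of `z₁` and `z₃`. -/
def outerAngle (J : ℝ) (V ϑ : ℝ → ℝ) (t : ℝ) : ℝ := (Real.arctan (V t / (4 * J)) - ϑ t) / 2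

/-- The angles of `z_j`. -/
def angles (J : ℝ) (V ϑ : ℝ → ℝ) : Fin 3 → ℝ → ℝ :=
  ![outerAngle J V ϑ, ϑ, outerAngle J V ϑ]

/-- The constant phases of the coordinates. -/
def initialPhase (θ : ℝ) (j : Fin 3) : ℂ := Complex.exp (Complex.I * initialAngle θ j)

/-- The solution of the Neumann system with `α = 0`, in terms of a radial motion. -/
def neumannCurve (θ J : ℝ) (x V ϑ : ℝ → ℝ) : ℝ → C3 :=
  fun t => WithLp.toLp 2 fun j =>
    initialPhase θ j * polarCurve (radial x j) (angles J V ϑ j) t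

/-- The derivative of `neumannCurve`. -/
def neumannVelocity (θ J : ℝ) (x V ϑ : ℝ → ℝ) : ℝ → C3 :=
  fun t => WithLp.toLp 2 fun j =>
    initialPhase θ j * (polarCurve (radial x j) (angles J V ϑ j) t *
      polarLogDeriv (radial x j t) (radialDeriv V j t) (J * mu 0 j))

/-- The second derivative of `neumannCurve`. -/
def neumannAcceleration (θ J : ℝ) (x V ϑ : ℝ → ℝ) : ℝ → C3 :=
  fun t => WithLp.toLp 2 fun j =>
    ((weight 0 j ^ 2 - 2 * (1 - x t) : ℝ) : ℂ) * neumannCurve θ J x V ϑ t j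

theorem norm_initialPhase (θ : ℝ) (j : Fin 3) : ‖initialPhase θ j‖ = 1 := by
  rw [initialPhase, mul_comm, Complex.norm_exp_ofReal_mul_I]

namespace IsRadialMotion

variable {J : ℝ} {x V ϑ : ℝ → ℝ} (h : IsRadialMotion J x V ϑ)

include h

theorem radial_pos (j : Fin 3) (t : ℝ) : 0 < radial x j t := by
  have h1 := h.x_pos t
  have h2 := h.x_lt_one t
  fin_cases j
  · simp only [radial, Fin.zero_eta, Matrix.cons_val]
    linarith
  · exact h1
  · simp only [radial, Fin.reduceFinMk, Matrix.cons_val]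
    linarith

theorem hasDerivAt_radial (j : Fin 3) (t : ℝ) :
    HasDerivAt (radial x j) (radialDeriv V j t) t := by
  have h1 := h.hasDerivAt_x t
  fin_cases j
  · exact (h1.const_sub 1).div_const 2
  · exact h1
  · exact (h1.const_sub 1).div_const 2

theorem hasDerivAt_radialDeriv (j : Fin 3) (t : ℝ) :
    HasDerivAt (radialDeriv V j) (radialDerivDeriv x j t) t := by
  have h1 := h.hasDerivAt_V t
  fin_cases j
  · exact (h1.neg.div_const 2).congr_deriv (by simp [radialDerivDeriv]; ring)
  · exact h1
  · exact (h1.neg.div_const 2).congr_deriv (by simp [radialDerivDeriv]; ring)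

/-- The energy relation gives `1 + (V / 4J)² = x (1 - x)² / (4 J²)`, so the arctangent has
derivative `2 J (1 - 3x) / (x (1 - x))`. Subtracting `2 J / x` and halving gives the angular speed
prescribed by the angular momentum `-J`. Thus the outer angle needs no separate quadrature. -/
theorem hasDerivAt_outerAngle (t : ℝ) :
    HasDerivAt (outerAngle J V ϑ) (-(2 * J) / (1 - x t)) t := by
  have h1 := (h.hasDerivAt_V t).div_const (4 * J)
  refine ((h1.arctan.sub (h.hasDerivAt_angle t)).div_const 2).congr_deriv ?_
  have hJ := h.J_pos.ne'
  have hx := (h.x_pos t).ne'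
  have hx1 : 1 - x t ≠ 0 := (sub_pos.2 (h.x_lt_one t)).ne'
  have he : 1 + (V t / (4 * J)) ^ 2 = x t * (1 - x t) ^ 2 / (4 * J ^ 2) := by
    rw [div_pow, h.energy]
    field_simp
    ring
  rw [he]
  field_simp
  ring

theorem hasDerivAt_angles (j : Fin 3) (t : ℝ) :
    HasDerivAt (angles J V ϑ j) (J * mu 0 j / radial x j t) t := by
  have hx1 : 1 - x t ≠ 0 := (sub_pos.2 (h.x_lt_one t)).ne'
  have h1 : J * mu 0 0 / radial x 0 t = -(2 * J) / (1 - x t) := by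
    simp only [mu, radial, Matrix.cons_val]
    field_simp
    ring
  have h2 : J * mu 0 2 / radial x 2 t = -(2 * J) / (1 - x t) := by
    simp only [mu, radial, Matrix.cons_val]
    field_simp
    ring
  fin_cases j
  · exact (h.hasDerivAt_outerAngle t).congr_deriv h1.symm
  · exact (h.hasDerivAt_angle t).congr_deriv (by simp [mu, radial, mul_comm])
  · exact (h.hasDerivAt_outerAngle t).congr_deriv h2.symm

theorem contDiff_radial (j : Fin 3) : ContDiff ℝ ∞ (radial x j) := by
  fin_cases j
  · exact (contDiff_const.sub h.contDiff_x).div_const 2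
  · exact h.contDiff_x
  · exact (contDiff_const.sub h.contDiff_x).div_const 2

theorem contDiff_angles (j : Fin 3) : ContDiff ℝ ∞ (angles J V ϑ j) :=
  contDiff_of_hasDerivAt
    (contDiff_const.div (h.contDiff_radial j) fun t => (h.radial_pos j t).ne')
    (h.hasDerivAt_angles j)

/-- The Neumann equation in polar form; for each coordinate it is a multiple of the energy relation.
-/
theorem radial_equation (j : Fin 3) (t : ℝ) :
    (radial x j t * radialDerivDeriv x j t / 2 - radialDeriv V j t ^ 2 / 4 - (J * mu 0 j) ^ 2) /
      radial x j t ^ 2 = weight 0 j ^ 2 - 2 * (1 - x t) := by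
  have he := h.energy t
  have hx1 : 1 - x t ≠ 0 := (sub_pos.2 (h.x_lt_one t)).ne'
  have hx := (h.x_pos t).ne'
  rw [div_eq_iff (pow_ne_zero 2 (h.radial_pos j t).ne')]
  fin_cases j
  · simp only [radial, radialDeriv, radialDerivDeriv, weight, mu, Fin.zero_eta, Matrix.cons_val]
    linear_combination (-1 / 16) * he
  · simp only [radial, radialDeriv, radialDerivDeriv, weight, mu, Fin.mk_one, Matrix.cons_val]
    linear_combination (-1 / 4) * he
  · simp only [radial, radialDeriv, radialDerivDeriv, weight, mu, Fin.reduceFinMk,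
      Matrix.cons_val]
    linear_combination (-1 / 16) * he

theorem hasDerivAt_neumannCurve (θ t : ℝ) :
    HasDerivAt (neumannCurve θ J x V ϑ) (neumannVelocity θ J x V ϑ t) t := by
  rw [hasDerivAt_euclidean]
  intro j
  exact (hasDerivAt_polarCurve (h.radial_pos j t) (h.hasDerivAt_radial j t)
    (h.hasDerivAt_angles j t)).const_mul _

theorem hasDerivAt_neumannVelocity (θ t : ℝ) :
    HasDerivAt (neumannVelocity θ J x V ϑ) (neumannAcceleration θ J x V ϑ t) t := by
  rw [hasDerivAt_euclidean]
  intro j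
  refine ((hasDerivAt_polarCurve_mul_polarLogDeriv (h.radial_pos j t) (h.hasDerivAt_radial j t)
    (h.hasDerivAt_angles j t) (h.hasDerivAt_radialDeriv j t)).const_mul _).congr_deriv ?_
  rw [h.radial_equation]
  simp only [neumannAcceleration, neumannCurve]
  ring

theorem contDiff_neumannCurve (θ : ℝ) : ContDiff ℝ ∞ (neumannCurve θ J x V ϑ) := by
  rw [contDiff_piLp]
  intro j
  exact contDiff_const.mul
    (contDiff_polarCurve (h.radial_pos j) (h.contDiff_radial j) (h.contDiff_angles j))

theorem norm_neumannCurve_sq (θ t : ℝ) (j : Fin 3) :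
    ‖neumannCurve θ J x V ϑ t j‖ ^ 2 = radial x j t := by
  simp only [neumannCurve]
  rw [norm_mul, norm_initialPhase, one_mul, norm_polarCurve_sq (h.radial_pos j t).le]

theorem norm_neumannVelocity_sq (θ t : ℝ) (j : Fin 3) :
    ‖neumannVelocity θ J x V ϑ t j‖ ^ 2 =
      (radialDeriv V j t ^ 2 / 4 + (J * mu 0 j) ^ 2) / radial x j t := by
  simp only [neumannVelocity]
  rw [norm_mul, norm_initialPhase, one_mul, norm_mul, mul_pow,
    norm_polarCurve_sq (h.radial_pos j t).le, norm_polarLogDeriv_sq]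
  have := (h.radial_pos j t).ne'
  field_simp

theorem sum_weight_sq (θ t : ℝ) :
    ∑ j, weight 0 j ^ 2 * ‖neumannCurve θ J x V ϑ t j‖ ^ 2 = 1 - x t := by
  simp only [h.norm_neumannCurve_sq, Fin.sum_univ_three, weight, radial, Matrix.cons_val]
  ring

theorem sum_norm_neumannVelocity_sq (θ t : ℝ) :
    ∑ j, ‖neumannVelocity θ J x V ϑ t j‖ ^ 2 = 1 - x t := by
  have hx1 : 1 - x t ≠ 0 := (sub_pos.2 (h.x_lt_one t)).ne'
  have hx := (h.x_pos t).ne'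
  have hV : (-V t / 2) ^ 2 = x t * (1 - x t) ^ 2 - 4 * J ^ 2 := by
    linear_combination (1 / 4) * h.energy t
  simp only [h.norm_neumannVelocity_sq, Fin.sum_univ_three, mu, radial, radialDeriv,
    Matrix.cons_val, hV, h.energy t]
  field_simp
  ring

theorem im_star_mul_neumannVelocity (θ t : ℝ) (j : Fin 3) :
    (starRingEnd ℂ (neumannCurve θ J x V ϑ t j) * neumannVelocity θ J x V ϑ t j).im =
      J * mu 0 j := by
  simp only [neumannCurve, neumannVelocity]
  rw [star_mul_mul_of_norm_eq_one (norm_initialPhase θ j),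
    im_star_polarCurve_mul (h.radial_pos j t)]

theorem isMinimalLegendrianImmersion (θ : ℝ) :
    IsMinimalLegendrianImmersion (equivariantMap 0 (neumannCurve θ J x V ϑ)) := by
  refine isMinimalLegendrianImmersion_equivariantMap (C := fun t => 2 * (1 - x t))
    (h.contDiff_neumannCurve θ) (h.hasDerivAt_neumannCurve θ) (h.hasDerivAt_neumannVelocity θ)
    ?_ ?_ ?_ ?_ ?_ ?_ ?_
  · intro t
    simp only [h.norm_neumannCurve_sq, Fin.sum_univ_three, radial, Matrix.cons_val]
    ring
  · intro t
    simp only [h.norm_neumannCurve_sq, Fin.sum_univ_three, radial, weight, Matrix.cons_val]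
    ring
  · intro t
    rw [h.sum_weight_sq]
    exact sub_pos.2 (h.x_lt_one t)
  · intro t
    rw [h.sum_weight_sq, h.sum_norm_neumannVelocity_sq]
  · intro t
    simp only [omega_eq_sum_im, h.im_star_mul_neumannVelocity, Fin.sum_univ_three, mu,
      Matrix.cons_val]
    ring
  · intro t
    simp only [h.im_star_mul_neumannVelocity, Fin.sum_univ_three, mu, weight, Matrix.cons_val]
    ring
  · intro t j
    simp only [neumannAcceleration]
    push_cast
    ring

theorem deriv_neumannCurve (θ : ℝ) :
    deriv (neumannCurve θ J x V ϑ) = neumannVelocity θ J x V ϑ :=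
  funext fun t => (h.hasDerivAt_neumannCurve θ t).deriv

theorem isNeumannSolution (θ : ℝ) : IsNeumannSolution 0 (neumannCurve θ J x V ϑ) := by
  refine ⟨contDiff_infty.1 (h.contDiff_neumannCurve θ) 2, fun t j => ?_⟩
  rw [h.deriv_neumannCurve, (h.hasDerivAt_neumannVelocity θ t).deriv, h.sum_weight_sq,
    EuclideanSpace.norm_sq_eq, h.sum_norm_neumannVelocity_sq]
  simp only [neumannAcceleration]
  push_cast
  ring

end IsRadialMotion

/-- Multiples of `4 π`, not `2 π`, are needed because the outer angles contain `-ϑ / 2`. -/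
theorem neumannCurve_add {J : ℝ} {x V ϑ : ℝ → ℝ} {T : ℝ} {m : ℤ} (hx : ∀ t, x (t + T) = x t)
    (hV : ∀ t, V (t + T) = V t) (hϑ : ∀ t, ϑ (t + T) = ϑ t + m * (4 * Real.pi)) (θ t : ℝ) :
    neumannCurve θ J x V ϑ (t + T) = neumannCurve θ J x V ϑ t := by
  have hr : ∀ j, radial x j (t + T) = radial x j t := by
    intro j
    fin_cases j <;> simp [radial, hx]
  have ha : ∀ j, ∃ n : ℤ, angles J V ϑ j (t + T) = angles J V ϑ j t + n * (2 * Real.pi) := by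
    intro j
    fin_cases j
    · refine ⟨-m, ?_⟩
      simp [angles, outerAngle, hV, hϑ]
      ring
    · refine ⟨2 * m, ?_⟩
      simp [angles, hϑ]
      ring
    · refine ⟨-m, ?_⟩
      simp [angles, outerAngle, hV, hϑ]
      ring
  ext j
  obtain ⟨n, hn⟩ := ha j
  simp only [neumannCurve, polarCurve, hr, hn]
  congr 2
  rw [Complex.exp_eq_exp_iff_exists_int]
  refine ⟨n, ?_⟩
  push_cast
  ring

/-- With `b = 1/3 + 2γ` the equation for `γ` becomes `b (1 - b)² = 4 J²`, whose left side is
strictly decreasing on `[1/3, 1]`. So a root there is the only one, and no smaller nonnegative `γ`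
competes. -/
theorem gammaPlus_zero_eq {J b : ℝ} (hb : 1 / 3 ≤ b) (hb1 : b < 1)
    (hJ : b * (1 - b) ^ 2 = 4 * J ^ 2) : gammaPlus 0 J = (b - 1 / 3) / 2 := by
  have hprod : ∀ γ, ∏ j, radiusSq 0 γ j = (1 / 3 - γ) ^ 2 * (1 / 3 + 2 * γ) := by
    intro γ
    simp only [Fin.prod_univ_three, radiusSq, mu, Matrix.cons_val]
    ring
  refine IsLeast.csInf_eq ⟨⟨by linarith, ?_⟩, ?_⟩
  · rw [hprod]
    linear_combination hJ / 4
  · rintro γ ⟨h0, h1⟩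
    rw [hprod] at h1
    by_contra! hlt
    -- The second factor is the difference quotient of `y (1 - y)²`, negative on the range in
    -- question.
    have h2 : (1 / 3 + 2 * γ - b) * ((1 / 3 + 2 * γ) ^ 2 + (1 / 3 + 2 * γ) * b + b ^ 2 -
        2 * (1 / 3 + 2 * γ) - 2 * b + 1) = 0 := by
      linear_combination 4 * h1 - hJ
    rcases mul_eq_zero.1 h2 with h3 | h3
    · linarith
    · nlinarith [mul_nonneg h0 (sub_nonneg.2 hb), mul_pos (sub_pos.2 hlt) (sub_pos.2 hb1)]

namespace IsRadialMotion

variable {J : ℝ} {x V ϑ : ℝ → ℝ} (h : IsRadialMotion J x V ϑ)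

include h

theorem initialRadius_eq (j : Fin 3) : initialRadius 0 J j = √(radial x j 0) := by
  have hg := gammaPlus_zero_eq h.third_le_x_zero (h.x_lt_one 0) (J := J) (by
    have := h.energy 0
    rw [h.V_zero] at this
    linarith)
  rw [initialRadius, hg]
  congr 1
  fin_cases j <;> simp [radiusSq, radial, mu] <;> ring

theorem angles_zero (j : Fin 3) : angles J V ϑ j 0 = 0 := by
  fin_cases j <;> simp [angles, outerAngle, h.V_zero, h.angle_zero]

theorem radialDeriv_zero (j : Fin 3) : radialDeriv V j 0 = 0 := by
  fin_cases j <;> simp [radialDeriv, h.V_zero]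

theorem isProfile (θ : ℝ) : IsProfile θ 0 J (neumannCurve θ J x V ϑ) := by
  refine ⟨h.isNeumannSolution θ, fun j => ?_, fun j => ?_⟩
  · simp only [neumannCurve, polarCurve, initialPhase, h.angles_zero, h.initialRadius_eq]
    simp [mul_comm]
  · rw [h.deriv_neumannCurve, h.initialRadius_eq]
    have hr := h.radial_pos j 0
    have hs : (√(radial x j 0) : ℂ) ≠ 0 := by exact_mod_cast (Real.sqrt_pos.2 hr).ne'
    have hr2 : (radial x j 0 : ℂ) = (√(radial x j 0) : ℂ) ^ 2 := by
      exact_mod_cast (Real.sq_sqrt hr.le).symm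
    simp only [neumannVelocity, polarCurve, polarLogDeriv, initialPhase, h.angles_zero,
      h.radialDeriv_zero]
    rw [hr2]
    push_cast
    simp only [mul_zero, Complex.exp_zero]
    field_simp
    simp [mul_comm]

end IsRadialMotion

/-! ### Uniqueness for the Neumann system -/

/-- Global uniqueness for autonomous differential equations with a `C¹` right hand side. -/
theorem eq_of_hasDerivAt_of_contDiff {E : Type*} [NormedAddCommGroup E] [NormedSpace ℝ E]
    [CompleteSpace E] {v : E → E} (hv : ContDiff ℝ 1 v) {f g : ℝ → E}
    (hf : ∀ t, HasDerivAt f (v (f t)) t) (hg : ∀ t, HasDerivAt g (v (g t)) t) (h0 : f 0 = g 0) :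
    f = g :=
  isMIntegralCurve_Ioo_eq_of_contMDiff_boundaryless (I := modelWithCornersSelf ℝ E) (v := v)
    (t₀ := 0) (contMDiff_vectorSpace_iff_contDiff.2 hv)
    (fun t => (hf t).hasFDerivAt.hasMFDerivAt) (fun t => (hg t).hasFDerivAt.hasMFDerivAt) h0

/-- The vector field on the phase space `ℂ³ × ℂ³` of the Neumann system. -/
def neumannField (α : ℝ) (p : C3 × C3) : C3 × C3 :=
  (p.2, WithLp.toLp 2 fun j =>
    ((weight α j ^ 2 - ((∑ i, weight α i ^ 2 * ‖p.1 i‖ ^ 2) + ‖p.2‖ ^ 2) : ℝ) : ℂ) * p.1 j)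

theorem contDiff_neumannField (α : ℝ) : ContDiff ℝ 1 (neumannField α) := by
  have hcoord : ∀ j, ContDiff ℝ 1 fun p : C3 × C3 => p.1 j := fun j =>
    (contDiff_piLp 2).1 contDiff_fst j
  refine contDiff_snd.prodMk ((contDiff_piLp 2).2 fun j => ?_)
  refine ContDiff.mul (Complex.ofRealCLM.contDiff.comp ?_) (hcoord j)
  refine contDiff_const.sub (ContDiff.add (ContDiff.sum fun i _ => ?_) ?_)
  · exact contDiff_const.mul ((hcoord i).norm_sq ℝ)
  · exact contDiff_snd.norm_sq ℝ

theorem IsNeumannSolution.hasDerivAt {α : ℝ} {z : ℝ → C3} (hz : IsNeumannSolution α z) (t : ℝ) :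
    HasDerivAt (fun t => (z t, deriv z t)) (neumannField α (z t, deriv z t)) t := by
  have h1 : HasDerivAt z (deriv z t) t := (hz.1.differentiable (by norm_num) t).hasDerivAt
  have h2 : HasDerivAt (deriv z) (deriv (deriv z) t) t := by
    have : ContDiff ℝ (1 + 1) z := hz.1
    rw [contDiff_succ_iff_deriv] at this
    exact (this.2.2.differentiable (by norm_num) t).hasDerivAt
  refine (h1.prodMk h2).congr_deriv (Prod.ext rfl ?_)
  ext j
  have := hz.2 t j
  simp only [neumannField]
  push_cast at this ⊢
  linear_combination this

theorem IsNeumannSolution.eq {α : ℝ} {z w : ℝ → C3} (hz : IsNeumannSolution α z)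
    (hw : IsNeumannSolution α w) (h0 : z 0 = w 0) (h1 : deriv z 0 = deriv w 0) : z = w := by
  have := eq_of_hasDerivAt_of_contDiff (contDiff_neumannField α) hz.hasDerivAt hw.hasDerivAt
    (Prod.ext h0 h1)
  exact funext fun t => congrArg Prod.fst (congrFun this t)

theorem IsProfile.eq {θ α J : ℝ} {z w : ℝ → C3} (hz : IsProfile θ α J z)
    (hw : IsProfile θ α J w) : z = w := by
  refine hz.neumann.eq hw.neumann ?_ ?_
  · ext j
    rw [hz.position, hw.position]
  · ext j
    rw [hz.velocity, hw.velocity]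

/-! ### Uniformisation of the radial motion

For `0 < e < 1 / 3` the radial motion with `J = e √(1 + e) / 2` is `x = 2 e² / D`, where
`D = 1 - e - √((1 + e) (1 - 3 e)) cos φ` and the angle `φ` satisfies an autonomous equation. -/

/-- The amplitude of the oscillation of `2 e² / x`. -/
def amplitude (e : ℝ) : ℝ := √((1 + e) * (1 - 3 * e))

/-- The quantity `2 e² / x` in terms of the uniformising angle. -/
def invRadius (e φ : ℝ) : ℝ := 1 - e - amplitude e * Real.cos φ

/-- The derivative of `invRadius` with respect to the angle. -/
def invRadiusDeriv (e φ : ℝ) : ℝ := amplitude e * Real.sin φ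

/-- The square of `e` times the angular speed, in terms of `invRadius`. -/
def speedSq (e D : ℝ) : ℝ := D * ((1 + e) * D - 2 * e ^ 2)

/-- The angular speed, multiplied by `e`. -/
def speed (e φ : ℝ) : ℝ := √(speedSq e (invRadius e φ))

/-- The constant `J` in terms of `e`. -/
def momentum (e : ℝ) : ℝ := e * √(1 + e) / 2

/-- The derivative of the angle of `z₂` with respect to the uniformising angle. -/
def angleDensity (e φ : ℝ) : ℝ := √(1 + e) * invRadius e φ / (2 * speed e φ)

/-- The increment of the angle of `z₂` over a period of the radial motion. -/
def rotationAngle (e : ℝ) : ℝ := primitive (angleDensity e) (2 * Real.pi)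

section

variable {e : ℝ} (he : e ∈ Set.Ioo (0 : ℝ) (1 / 3))

include he

theorem amplitude_sq : amplitude e ^ 2 = (1 + e) * (1 - 3 * e) :=
  Real.sq_sqrt (mul_nonneg (by linarith [he.1]) (by linarith [he.2]))

theorem amplitude_pos : 0 < amplitude e :=
  Real.sqrt_pos.2 (mul_pos (by linarith [he.1]) (by linarith [he.2]))

/-- The squares differ by `4 e³ + 4 e⁴`. This bound yields `x < 1`. -/
theorem amplitude_lt : amplitude e < 1 - e - 2 * e ^ 2 := by
  obtain ⟨h0, h1⟩ := he
  refine (Real.sqrt_lt' (by nlinarith)).2 ?_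
  nlinarith [pow_pos h0 3, pow_pos h0 4]

/-- Equivalent to `x ≥ 1/3` at `φ = 0`: the motion starts at the larger turning point, the one
selected by `gammaPlus`. -/
theorem le_amplitude : 1 - e - 6 * e ^ 2 ≤ amplitude e := by
  obtain ⟨h0, h1⟩ := he
  refine Real.le_sqrt_of_sq_le ?_
  have h2 : 0 ≤ e ^ 2 * (8 + 12 * e) * (1 - 3 * e) :=
    mul_nonneg (by positivity) (by linarith)
  nlinarith

theorem two_mul_sq_lt_invRadius (φ : ℝ) : 2 * e ^ 2 < invRadius e φ := by
  have h1 := amplitude_lt he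
  have h2 := mul_le_mul_of_nonneg_left (Real.cos_le_one φ) (amplitude_pos he).le
  rw [invRadius]
  linarith

theorem invRadius_pos (φ : ℝ) : 0 < invRadius e φ :=
  lt_of_le_of_lt (by positivity) (two_mul_sq_lt_invRadius he φ)

theorem speedSq_pos (φ : ℝ) : 0 < speedSq e (invRadius e φ) := by
  have h1 := two_mul_sq_lt_invRadius he φ
  have h2 := invRadius_pos he φ
  refine mul_pos h2 ?_
  nlinarith [mul_pos he.1 h2]

theorem speed_pos (φ : ℝ) : 0 < speed e φ := Real.sqrt_pos.2 (speedSq_pos he φ)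

theorem speed_sq (φ : ℝ) : speed e φ ^ 2 = speedSq e (invRadius e φ) :=
  Real.sq_sqrt (speedSq_pos he φ).le

theorem invRadiusDeriv_sq (φ : ℝ) : invRadiusDeriv e φ ^ 2 =
    -invRadius e φ ^ 2 + 2 * (1 - e) * invRadius e φ - 4 * e ^ 2 := by
  rw [invRadiusDeriv, invRadius, mul_pow, Real.sin_sq, amplitude_sq he]
  linear_combination (- Real.cos φ ^ 2) * amplitude_sq he + (2 * Real.cos φ ^ 2) * amplitude_sq he

omit he in
theorem hasDerivAt_invRadius (e φ : ℝ) :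
    HasDerivAt (invRadius e) (invRadiusDeriv e φ) φ := by
  refine (((Real.hasDerivAt_cos φ).const_mul (amplitude e)).const_sub (1 - e)).congr_deriv ?_
  rw [invRadiusDeriv]
  ring

omit he in
theorem hasDerivAt_invRadiusDeriv (e φ : ℝ) :
    HasDerivAt (invRadiusDeriv e) (1 - e - invRadius e φ) φ := by
  refine ((Real.hasDerivAt_sin φ).const_mul (amplitude e)).congr_deriv ?_
  rw [invRadius]
  ring

theorem hasDerivAt_speed (φ : ℝ) : HasDerivAt (speed e)
    (((1 + e) * invRadius e φ - e ^ 2) * invRadiusDeriv e φ / speed e φ) φ := by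
  have h1 := hasDerivAt_invRadius e φ
  have h2 : HasDerivAt (fun φ => speedSq e (invRadius e φ)) _ φ :=
    h1.mul ((h1.const_mul (1 + e)).sub_const (2 * e ^ 2))
  refine (h2.sqrt (speedSq_pos he φ).ne').congr_deriv ?_
  rw [← speed]
  have := (speed_pos he φ).ne'
  field_simp
  ring

omit he in
theorem contDiff_invRadius (e : ℝ) : ContDiff ℝ ∞ (invRadius e) :=
  contDiff_const.sub (contDiff_const.mul Real.contDiff_cos)

theorem contDiff_speed : ContDiff ℝ ∞ (speed e) := by
  have h1 := contDiff_invRadius e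
  exact ContDiff.sqrt (h1.mul ((contDiff_const.mul h1).sub contDiff_const))
    fun φ => (speedSq_pos he φ).ne'

omit he in
theorem invRadius_periodic (e : ℝ) : Function.Periodic (invRadius e) (2 * Real.pi) := fun φ => by
  simp [invRadius]

omit he in
theorem invRadiusDeriv_periodic (e : ℝ) : Function.Periodic (invRadiusDeriv e) (2 * Real.pi) :=
  fun φ => by simp [invRadiusDeriv]

omit he in
theorem speed_periodic (e : ℝ) : Function.Periodic (speed e) (2 * Real.pi) := fun φ => by
  simp only [speed, invRadius_periodic e φ]

/-- The time that the uniformising angle takes, as a function of that angle. -/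
def clock (e : ℝ) : ℝ → ℝ := primitive fun φ => e / speed e φ

/-- The uniformising angle at a given time. -/
def uniformAngle (e : ℝ) : ℝ → ℝ := Function.invFun (clock e)

theorem continuous_clock_integrand : Continuous fun φ => e / speed e φ :=
  continuous_const.div (contDiff_speed he).continuous fun φ => (speed_pos he φ).ne'

theorem clock_integrand_pos (φ : ℝ) : 0 < e / speed e φ := div_pos he.1 (speed_pos he φ)

omit he in
theorem clock_integrand_periodic (e : ℝ) :
    Function.Periodic (fun φ => e / speed e φ) (2 * Real.pi) := fun φ => by
  simp only [speed_periodic e φ]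

theorem clock_two_pi_pos : 0 < clock e (2 * Real.pi) := by
  have := primitive_strictMono (continuous_clock_integrand he) (clock_integrand_pos he)
    Real.two_pi_pos
  rwa [primitive_zero] at this

theorem hasDerivAt_uniformAngle (t : ℝ) :
    HasDerivAt (uniformAngle e) (speed e (uniformAngle e t) / e) t := by
  have := hasDerivAt_invFun_primitive (continuous_clock_integrand he) (clock_integrand_pos he)
    (clock_integrand_periodic e) Real.two_pi_pos t
  rwa [inv_div] at this

theorem uniformAngle_zero : uniformAngle e 0 = 0 :=
  invFun_primitive_zero (continuous_clock_integrand he) (clock_integrand_pos he)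

theorem uniformAngle_add (t : ℝ) (n : ℕ) :
    uniformAngle e (t + n * clock e (2 * Real.pi)) = uniformAngle e t + n * (2 * Real.pi) :=
  invFun_primitive_add_nat_mul (continuous_clock_integrand he) (clock_integrand_pos he)
    (clock_integrand_periodic e) Real.two_pi_pos t n

theorem contDiff_uniformAngle : ContDiff ℝ ∞ (uniformAngle e) :=
  contDiff_of_hasDerivAt_comp ((contDiff_speed he).div_const e) (hasDerivAt_uniformAngle he)

theorem continuous_angleDensity : Continuous (angleDensity e) :=
  (continuous_const.mul (contDiff_invRadius e).continuous).div
    (continuous_const.mul (contDiff_speed he).continuous)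
    fun φ => mul_ne_zero two_ne_zero (speed_pos he φ).ne'

omit he in
theorem angleDensity_periodic (e : ℝ) : Function.Periodic (angleDensity e) (2 * Real.pi) :=
  fun φ => by simp only [angleDensity, invRadius_periodic e φ, speed_periodic e φ]

end

/-- The radial motion `x`. -/
def motionRadius (e t : ℝ) : ℝ := 2 * e ^ 2 / invRadius e (uniformAngle e t)

/-- The derivative of `motionRadius`. -/
def motionVelocity (e t : ℝ) : ℝ :=
  -(2 * e) * (invRadiusDeriv e (uniformAngle e t) * speed e (uniformAngle e t)) /
    invRadius e (uniformAngle e t) ^ 2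

/-- The angle of `z₂` along the radial motion. -/
def motionAngle (e t : ℝ) : ℝ := primitive (angleDensity e) (uniformAngle e t)

/-- In the variable `φ` the turning points of `x` are no longer singular: `φ` increases at positive
speed `S / e`, and the oscillation sits in `cos φ`. -/
theorem isRadialMotion_motionRadius {e : ℝ} (he : e ∈ Set.Ioo (0 : ℝ) (1 / 3)) :
    IsRadialMotion (momentum e) (motionRadius e) (motionVelocity e) (motionAngle e) := by
  have h0 := he.1.ne'
  have hw : √(1 + e) ^ 2 = 1 + e := Real.sq_sqrt (by linarith [he.1])
  have hwpos : 0 < √(1 + e) := Real.sqrt_pos.2 (by linarith [he.1])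
  have hU := hasDerivAt_uniformAngle he
  refine ⟨fun t => ?_, fun t => ?_, fun t => ?_, fun t => ?_, ?_, fun t => ?_, fun t => ?_, ?_,
    ?_, ?_, ?_⟩
  · have hD := (invRadius_pos he (uniformAngle e t)).ne'
    have h1 := (hasDerivAt_invRadius e (uniformAngle e t)).comp t (hU t)
    refine ((hasDerivAt_const t (2 * e ^ 2)).div h1 hD).congr_deriv ?_
    rw [motionVelocity]
    simp only [Function.comp_apply]
    field_simp
    ring
  · have hD := (invRadius_pos he (uniformAngle e t)).ne'
    have hS := (speed_pos he (uniformAngle e t)).ne'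
    have hS2 := speed_sq he (uniformAngle e t)
    have hσ2 := invRadiusDeriv_sq he (uniformAngle e t)
    have h1 := hasDerivAt_invRadius e (uniformAngle e t)
    have h2 := hasDerivAt_invRadiusDeriv e (uniformAngle e t)
    have h3 := hasDerivAt_speed he (uniformAngle e t)
    refine (((((h2.mul h3).const_mul (-(2 * e))).div (h1.pow 2) (pow_ne_zero 2 hD)).comp t
      (hU t))).congr_deriv ?_
    rw [motionRadius]
    rw [speedSq] at hS2
    simp only [Pi.mul_apply, Pi.pow_apply]
    -- From here `D`, `σ`, `S` are free variables subject only to the polynomial expressions of `S²`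
    -- and `σ²` in `D`.
    generalize invRadius e (uniformAngle e t) = D at *
    generalize invRadiusDeriv e (uniformAngle e t) = σ at *
    generalize speed e (uniformAngle e t) = S at *
    have key : (-2) * ((1 - e - D) * S ^ 2 * D + σ ^ 2 * ((1 + e) * D - e ^ 2) * D -
        2 * σ ^ 2 * S ^ 2) = 2 * (D - 2 * e ^ 2) * (D - 6 * e ^ 2) * D := by
      rw [hS2, hσ2]
      ring
    trans (-2) * ((1 - e - D) * S ^ 2 * D + σ ^ 2 * ((1 + e) * D - e ^ 2) * D -
        2 * σ ^ 2 * S ^ 2) / D ^ 3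
    · field_simp
      ring
    · rw [key]
      field_simp
      ring
  · refine ((hasDerivAt_primitive (continuous_angleDensity he) _).comp t (hU t)).congr_deriv ?_
    have hS := (speed_pos he (uniformAngle e t)).ne'
    rw [angleDensity, momentum, motionRadius]
    field_simp
  · have hD := (invRadius_pos he (uniformAngle e t)).ne'
    have hS2 := speed_sq he (uniformAngle e t)
    have hσ2 := invRadiusDeriv_sq he (uniformAngle e t)
    rw [speedSq] at hS2
    rw [motionVelocity, motionRadius, momentum]
    simp only [div_pow, mul_pow, hw, hS2, hσ2]
    field_simp
    ring
  · exact div_pos (mul_pos he.1 hwpos) two_pos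
  · exact div_pos (mul_pos two_pos (pow_pos he.1 2)) (invRadius_pos he _)
  · rw [motionRadius, div_lt_one (invRadius_pos he _)]
    exact two_mul_sq_lt_invRadius he _
  · exact contDiff_const.div ((contDiff_invRadius e).comp (contDiff_uniformAngle he))
      fun t => (invRadius_pos he _).ne'
  · simp [motionVelocity, uniformAngle_zero he, invRadiusDeriv]
  · simp [motionAngle, uniformAngle_zero he, primitive_zero]
  · rw [motionRadius, uniformAngle_zero he, div_le_div_iff₀ three_pos (invRadius_pos he _),
      invRadius, Real.cos_zero]
    linarith [le_amplitude he]

theorem givesMinimalLegendrianTorus_neumannCurve {e : ℝ} (he : e ∈ Set.Ioo (0 : ℝ) (1 / 3))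
    {q : ℚ} (hq : rotationAngle e = q * (2 * Real.pi)) (θ : ℝ) :
    GivesMinimalLegendrianTorus (equivariantMap 0
      (neumannCurve θ (momentum e) (motionRadius e) (motionVelocity e) (motionAngle e))) := by
  have hq' : (q : ℝ) * q.den = q.num := by exact_mod_cast Rat.mul_den_eq_num q
  -- After `2 * q.den` radial periods `ϑ` has grown by `4 π * q.num`, so the half-angles close up
  -- too.
  set T : ℝ := (2 * q.den : ℕ) * clock e (2 * Real.pi) with hT
  have hU : ∀ t, uniformAngle e (t + T) = uniformAngle e t + (2 * q.den : ℕ) * (2 * Real.pi) :=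
    fun t => uniformAngle_add he t _
  have hD : ∀ t, invRadius e (uniformAngle e (t + T)) = invRadius e (uniformAngle e t) := fun t =>
    by rw [hU, (invRadius_periodic e).nat_mul]
  have hσ : ∀ t, invRadiusDeriv e (uniformAngle e (t + T)) = invRadiusDeriv e (uniformAngle e t) :=
    fun t => by rw [hU, (invRadiusDeriv_periodic e).nat_mul]
  have hS : ∀ t, speed e (uniformAngle e (t + T)) = speed e (uniformAngle e t) :=
    fun t => by rw [hU, (speed_periodic e).nat_mul]
  have hT0 : T ≠ 0 := by
    have h1 : (2 * q.den : ℕ) ≠ 0 := mul_ne_zero two_ne_zero q.den_nz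
    exact mul_ne_zero (by exact_mod_cast h1) (clock_two_pi_pos he).ne'
  refine givesMinimalLegendrianTorus_of_periodic (P := 2 * Real.pi) (T := T)
    ((isRadialMotion_motionRadius he).isMinimalLegendrianImmersion θ) Real.two_pi_pos.ne' hT0 ?_ ?_
  · refine equivariantMap_add_fst (n := ![1, 0, -1]) (fun j => ?_) _
    fin_cases j <;> simp [weight]
  · intro s t
    have := neumannCurve_add (J := momentum e) (x := motionRadius e)
      (V := motionVelocity e) (ϑ := motionAngle e) (T := T) (m := q.num) (fun t => ?_)
      (fun t => ?_) (fun t => ?_) θ t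
    · simp only [equivariantMap, this]
    · rw [motionRadius, hD, motionRadius]
    · rw [motionVelocity, hD, hσ, hS, motionVelocity]
    · rw [motionAngle, hU, primitive_add_nat_mul_period (continuous_angleDensity he)
        (angleDensity_periodic e), ← rotationAngle, hq, ← motionAngle]
      push_cast
      linear_combination (4 * Real.pi) * hq'

/-! ### Monotonicity of the rotation angle -/

/-- The derivative of `angleDensity` with respect to `e`. -/
def angleDensityDeriv (e φ : ℝ) : ℝ :=
  e * invRadius e φ * ((1 - 2 * e) * invRadius e φ - 2 * e ^ 2) /
    (√(1 + e) * speed e φ ^ 3 * (1 - 3 * e))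

/-- A periodic function of the uniformising angle whose derivative differs from a multiple of
`angleDensityDeriv` by a nonnegative function. -/
def corrector (e φ : ℝ) : ℝ :=
  -(6 * e ^ 2) * √(1 + e) * (invRadiusDeriv e φ / speed e φ) +
    2 * e ^ 2 * √(1 + e) * (invRadiusDeriv e φ * speed e φ /
      (invRadius e φ * (invRadius e φ - 2 * e ^ 2)))

/-- The nonnegative part of the multiple of `angleDensityDeriv`. -/
def positivePart (e φ : ℝ) : ℝ :=
  4 * e ^ 4 * √(1 + e) * (invRadiusDeriv e φ ^ 2 * speed e φ /
    (invRadius e φ ^ 2 * (invRadius e φ - 2 * e ^ 2) ^ 2))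

section

variable {e : ℝ} (he : e ∈ Set.Ioo (0 : ℝ) (1 / 3))

include he

theorem hasDerivAt_angleDensity (φ : ℝ) :
    HasDerivAt (fun e => angleDensity e φ) (angleDensityDeriv e φ) e := by
  have hd : 0 < 1 + e := by linarith [he.1]
  have hm : 1 - e * 3 ≠ 0 := by linarith [he.2]
  have hd' := hd.ne'
  have hw0 := (Real.sqrt_pos.2 hd).ne'
  have hw : √(1 + e) ^ 2 = 1 + e := Real.sq_sqrt hd.le
  have hh0 := (amplitude_pos he).ne'
  have hh := amplitude_sq he
  have hid := hasDerivAt_id' e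
  have h1 : HasDerivAt (fun e : ℝ => 1 + e) 1 e := hid.const_add 1
  have h2 : HasDerivAt (fun e : ℝ => 1 - 3 * e) (-3) e := by
    simpa using (hid.const_mul 3).const_sub 1
  have hamp : HasDerivAt amplitude (-(1 + 3 * e) / amplitude e) e := by
    refine ((h1.mul h2).sqrt (mul_pos hd (by linarith [he.2])).ne').congr_deriv ?_
    change _ / (2 * amplitude e) = _
    field_simp
    ring
  -- The cosine is eliminated through `h cos φ = 1 - e - D`, with `h` the amplitude, so that only
  -- `h²` remains.
  have hDd : HasDerivAt (fun e => invRadius e φ)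
      (-1 + (1 + 3 * e) * (1 - e - invRadius e φ) / ((1 + e) * (1 - 3 * e))) e := by
    refine ((hid.const_sub 1).sub (hamp.mul_const (Real.cos φ))).congr_deriv ?_
    rw [← hh, invRadius]
    field_simp
    ring
  have hQ : HasDerivAt (fun e => speedSq e (invRadius e φ)) _ e :=
    hDd.mul ((h1.mul hDd).sub ((hid.pow 2).const_mul 2))
  have hS := hQ.sqrt (speedSq_pos he φ).ne'
  have hS0 := (speed_pos he φ).ne'
  have hS2 := speed_sq he φ
  refine (((h1.sqrt hd').mul hDd).div (hS.const_mul 2) (mul_ne_zero two_ne_zero hS0)).congr_deriv ?_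
  rw [angleDensityDeriv]
  rw [← speed]
  rw [speedSq] at hS2
  simp only [Pi.mul_apply]
  generalize invRadius e φ = D at *
  generalize speed e φ = S at *
  generalize √(1 + e) = w at *
  have key : ∀ D' Q' : ℝ, D' = -1 + (1 + 3 * e) * (1 - e - D) / ((1 + e) * (1 - 3 * e)) →
      Q' = D' * ((1 + e) * D - 2 * e ^ 2) + D * (D + (1 + e) * D' - 4 * e) →
      ((1 / (2 * w) * D + w * D') * (2 * S) - w * D * (2 * (Q' / (2 * S)))) / (2 * S) ^ 2 =
        e * D * ((1 - 2 * e) * D - 2 * e ^ 2) / (w * S ^ 3 * (1 - 3 * e)) := by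
    intro D' Q' hD' hQ'
    trans (D * S ^ 2 + 2 * w ^ 2 * D' * S ^ 2 - w ^ 2 * D * Q') / (4 * w * S ^ 3)
    · field_simp
      ring
    · rw [hw, hS2, hQ', hD']
      field_simp
      ring
  refine Eq.trans ?_ (key _ _ rfl rfl)
  simp
  ring

/-- `angleDensityDeriv` need not be positive pointwise: `(1 - 2e) D - 2 e²` can be negative near the
minimum of `D` when `e` is small. Subtracting this exact derivative from a positive multiple of it
leaves an expression in squares. -/
theorem hasDerivAt_corrector (φ : ℝ) :
    HasDerivAt (corrector e)
      (2 * e * (1 + e) * (1 - 3 * e) * (3 * e + 2) * angleDensityDeriv e φ - positivePart e φ)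
      φ := by
  have hd : 0 < 1 + e := by linarith [he.1]
  have hm : 1 - e * 3 ≠ 0 := by linarith [he.2]
  have hw0 := (Real.sqrt_pos.2 hd).ne'
  have hw : √(1 + e) ^ 2 = 1 + e := Real.sq_sqrt hd.le
  have h1 := hasDerivAt_invRadius e φ
  have h2 := hasDerivAt_invRadiusDeriv e φ
  have h3 := hasDerivAt_speed he φ
  have hD0 := (invRadius_pos he φ).ne'
  have hD1 : invRadius e φ - 2 * e ^ 2 ≠ 0 := (sub_pos.2 (two_mul_sq_lt_invRadius he φ)).ne'
  have hS0 := (speed_pos he φ).ne'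
  have hS2 := speed_sq he φ
  have hσ2 := invRadiusDeriv_sq he φ
  refine (((h2.div h3 hS0).const_mul (-(6 * e ^ 2) * √(1 + e))).add
    (((h2.mul h3).div (h1.mul (h1.sub_const (2 * e ^ 2)))
      (mul_ne_zero hD0 hD1)).const_mul (2 * e ^ 2 * √(1 + e)))).congr_deriv ?_
  rw [angleDensityDeriv, positivePart]
  rw [speedSq] at hS2
  simp only [Pi.mul_apply]
  generalize invRadius e φ = D at *
  generalize invRadiusDeriv e φ = σ at *
  generalize speed e φ = S at *
  generalize √(1 + e) = w at *
  have hS4 : S ^ 4 = (D * ((1 + e) * D - 2 * e ^ 2)) ^ 2 := by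
    rw [← hS2]
    ring
  have key : -(6 * e ^ 2) * ((1 - e - D) * S ^ 2 - σ ^ 2 * ((1 + e) * D - e ^ 2)) +
      2 * e ^ 2 * (((1 - e - D) * S ^ 4 + σ ^ 2 * ((1 + e) * D - e ^ 2) * S ^ 2) /
        (D * (D - 2 * e ^ 2)) - σ ^ 2 * S ^ 4 * (2 * D - 2 * e ^ 2) /
        (D * (D - 2 * e ^ 2)) ^ 2) =
      2 * e ^ 2 * (3 * e + 2) * D * ((1 - 2 * e) * D - 2 * e ^ 2) -
        4 * e ^ 4 * σ ^ 2 * S ^ 4 / (D * (D - 2 * e ^ 2)) ^ 2 := by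
    rw [hS4, hS2, hσ2]
    -- Naming the denominator `D - 2 e²` makes it an atom while fractions are cleared.
    obtain ⟨E, hE⟩ : ∃ E, E = D - 2 * e ^ 2 := ⟨_, rfl⟩
    rw [← hE] at hD1 ⊢
    field_simp
    rw [show D = E + 2 * e ^ 2 by rw [hE]; ring]
    ring
  trans w / S ^ 3 * (-(6 * e ^ 2) * ((1 - e - D) * S ^ 2 - σ ^ 2 * ((1 + e) * D - e ^ 2)) +
      2 * e ^ 2 * (((1 - e - D) * S ^ 4 + σ ^ 2 * ((1 + e) * D - e ^ 2) * S ^ 2) /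
        (D * (D - 2 * e ^ 2)) - σ ^ 2 * S ^ 4 * (2 * D - 2 * e ^ 2) /
        (D * (D - 2 * e ^ 2)) ^ 2))
  · field_simp
    ring
  · rw [key, ← hw]
    field_simp

theorem continuous_positivePart : Continuous (positivePart e) := by
  have h1 := (contDiff_invRadius e).continuous
  have h2 : Continuous (invRadiusDeriv e) := continuous_const.mul Real.continuous_sin
  have h3 := (contDiff_speed he).continuous
  refine continuous_const.mul (((h2.pow 2).mul h3).div
    ((h1.pow 2).mul ((h1.sub continuous_const).pow 2)) fun φ => ?_)
  exact mul_ne_zero (pow_ne_zero 2 (invRadius_pos he φ).ne')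
    (pow_ne_zero 2 (sub_pos.2 (two_mul_sq_lt_invRadius he φ)).ne')

omit he in
theorem continuousOn_angleDensityDeriv :
    ContinuousOn (fun p : ℝ × ℝ => angleDensityDeriv p.1 p.2)
      (Set.Ioo (0 : ℝ) (1 / 3) ×ˢ Set.univ) := by
  have hD : Continuous fun p : ℝ × ℝ => invRadius p.1 p.2 := by
    unfold invRadius amplitude
    fun_prop
  have hS : Continuous fun p : ℝ × ℝ => speed p.1 p.2 := by
    unfold speed speedSq
    fun_prop
  unfold angleDensityDeriv
  refine ContinuousOn.div (by fun_prop) (by fun_prop) ?_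
  rintro ⟨e, φ⟩ ⟨he, -⟩
  have hd : 0 < 1 + e := by linarith [he.1]
  have hm : 1 - 3 * e ≠ 0 := by
    have := he.2
    simp only at this
    linarith
  exact mul_ne_zero (mul_ne_zero (Real.sqrt_pos.2 hd).ne'
    (pow_ne_zero 3 (speed_pos he φ).ne')) hm

theorem continuous_angleDensityDeriv : Continuous (angleDensityDeriv e) := by
  have := continuousOn_angleDensityDeriv.comp_continuous (f := fun φ : ℝ => (e, φ)) (by fun_prop)
    fun φ => ⟨he, Set.mem_univ φ⟩
  exact this

/-- The corrector vanishes at `0` and `2 π`, where `sin φ = 0`. Hence `c` times the integral equals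
that of `positivePart`, which is nonnegative everywhere and positive at `φ = π / 2`. -/
theorem integral_angleDensityDeriv_pos :
    0 < ∫ φ in (0 : ℝ)..(2 * Real.pi), angleDensityDeriv e φ := by
  have hP := continuous_positivePart he
  have hA := continuous_angleDensityDeriv he
  set c := 2 * e * (1 + e) * (1 - 3 * e) * (3 * e + 2) with hc
  have h0 := he.1
  have hcpos : 0 < c :=
    mul_pos (mul_pos (by positivity) (by linarith [he.2])) (by positivity)
  have hint : ∫ φ in (0 : ℝ)..(2 * Real.pi), (c * angleDensityDeriv e φ - positivePart e φ) = 0 := by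
    rw [intervalIntegral.integral_eq_sub_of_hasDerivAt (fun φ _ => hasDerivAt_corrector he φ)
      ((hA.const_mul c).sub hP |>.intervalIntegrable _ _)]
    simp [corrector, invRadiusDeriv]
  rw [intervalIntegral.integral_sub ((hA.const_mul c).intervalIntegrable _ _)
    (hP.intervalIntegrable _ _), intervalIntegral.integral_const_mul, sub_eq_zero] at hint
  have hd : 0 < √(1 + e) := Real.sqrt_pos.2 (by linarith)
  have hnonneg : ∀ φ, 0 ≤ positivePart e φ := fun φ => by
    have := speed_pos he φ
    unfold positivePart
    positivity
  have hpos : 0 < ∫ φ in (0 : ℝ)..(2 * Real.pi), positivePart e φ := by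
    refine intervalIntegral.integral_pos Real.two_pi_pos hP.continuousOn (fun φ _ => hnonneg φ)
      ⟨Real.pi / 2, ⟨by positivity, by linarith [Real.pi_pos]⟩, ?_⟩
    have h1 := speed_pos he (Real.pi / 2)
    have h2 := invRadius_pos he (Real.pi / 2)
    have h3 := sub_pos.2 (two_mul_sq_lt_invRadius he (Real.pi / 2))
    have h4 : 0 < invRadiusDeriv e (Real.pi / 2) := by
      simpa [invRadiusDeriv] using amplitude_pos he
    unfold positivePart
    positivity
  rw [← hint] at hpos
  exact (mul_pos_iff_of_pos_left hcpos).1 hpos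

/-- Differentiation under the integral sign; the dominating constant comes from compactness of a
closed ball in `e` times `[0, 2π]`. -/
theorem hasDerivAt_rotationAngle : HasDerivAt rotationAngle
    (∫ φ in (0 : ℝ)..(2 * Real.pi), angleDensityDeriv e φ) e := by
  obtain ⟨δ, hδ, hsub⟩ := Metric.nhds_basis_closedBall.mem_iff.1 (Ioo_mem_nhds he.1 he.2)
  have hcpt : IsCompact (Metric.closedBall e δ ×ˢ Set.Icc (0 : ℝ) (2 * Real.pi)) :=
    (isCompact_closedBall e δ).prod isCompact_Icc
  obtain ⟨B, hB⟩ := hcpt.exists_bound_of_continuousOn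
    (continuousOn_angleDensityDeriv.mono (Set.prod_mono hsub (Set.subset_univ _)))
  have hnear : ∀ᶠ x in nhds e, x ∈ Set.Ioo (0 : ℝ) (1 / 3) := Ioo_mem_nhds he.1 he.2
  refine (intervalIntegral.hasDerivAt_integral_of_dominated_loc_of_deriv_le
    (F := angleDensity) (F' := angleDensityDeriv) (bound := fun _ => B)
    (Metric.closedBall_mem_nhds e hδ) ?_ ?_ ?_ ?_ ?_ ?_).2
  · filter_upwards [hnear] with x hx
    exact (continuous_angleDensity hx).aestronglyMeasurable
  · exact (continuous_angleDensity he).intervalIntegrable _ _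
  · exact (continuous_angleDensityDeriv he).aestronglyMeasurable
  · refine Filter.Eventually.of_forall fun φ hφ x hx => hB (x, φ) ⟨hx, ?_⟩
    rw [Set.uIoc_of_le Real.two_pi_pos.le] at hφ
    exact Set.Ioc_subset_Icc_self hφ
  · exact intervalIntegrable_const
  · exact Filter.Eventually.of_forall fun φ _ x hx => hasDerivAt_angleDensity (hsub hx) φ

end

/-! ### Density of the parameters with rational rotation angle -/

theorem continuousOn_rotationAngle : ContinuousOn rotationAngle (Set.Ioo (0 : ℝ) (1 / 3)) :=
  fun _ he => (hasDerivAt_rotationAngle he).continuousAt.continuousWithinAt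

theorem strictMonoOn_rotationAngle : StrictMonoOn rotationAngle (Set.Ioo (0 : ℝ) (1 / 3)) := by
  refine strictMonoOn_of_deriv_pos (convex_Ioo _ _) continuousOn_rotationAngle fun e he => ?_
  rw [interior_Ioo] at he
  rw [(hasDerivAt_rotationAngle he).deriv]
  exact integral_angleDensityDeriv_pos he

/-- The parameters for which the rotation angle is a rational multiple of `2 π`. -/
def rationalParameters : Set ℝ :=
  {e | e ∈ Set.Ioo (0 : ℝ) (1 / 3) ∧ ∃ q : ℚ, rotationAngle e = q * (2 * Real.pi)}

theorem Ioo_subset_closure_rationalParameters :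
    Set.Ioo (0 : ℝ) (1 / 3) ⊆ closure rationalParameters := by
  intro e he
  rw [Metric.mem_closure_iff]
  intro ε hε
  obtain ⟨b, heb, hb⟩ := exists_between (lt_min he.2 (lt_add_of_pos_right e hε))
  have hb' := lt_min_iff.1 hb
  have hbm : b ∈ Set.Ioo (0 : ℝ) (1 / 3) := ⟨he.1.trans heb, hb'.1⟩
  have hlt := div_lt_div_of_pos_right (strictMonoOn_rotationAngle he hbm heb) Real.two_pi_pos
  -- Strict monotonicity leaves room for a rational multiple of `2 π`, which the intermediate value
  -- theorem attains between `e` and `b`.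
  obtain ⟨q, hq1, hq2⟩ := exists_rat_btwn hlt
  rw [div_lt_iff₀ Real.two_pi_pos] at hq1
  rw [lt_div_iff₀ Real.two_pi_pos] at hq2
  have hsub : Set.Icc e b ⊆ Set.Ioo (0 : ℝ) (1 / 3) := fun x hx =>
    ⟨he.1.trans_le hx.1, hx.2.trans_lt hb'.1⟩
  obtain ⟨x, hx, hxq⟩ := intermediate_value_Icc heb.le (continuousOn_rotationAngle.mono hsub)
    ⟨hq1.le, hq2.le⟩
  refine ⟨x, ⟨hsub hx, q, hxq⟩, ?_⟩
  rw [dist_comm, Real.dist_eq, abs_of_nonneg (sub_nonneg.2 hx.1)]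
  linarith [hx.2, hb'.2]

theorem continuous_momentum : Continuous momentum := by
  unfold momentum
  fun_prop

/-- At `e = 1/3` the amplitude vanishes; this is the upper end of the range of `J`. -/
theorem momentum_third : momentum (1 / 3) = 1 / (3 * √3) := by
  have h3 : √3 ^ 2 = (3 : ℝ) := Real.sq_sqrt (by norm_num)
  have h : √(1 + 1 / 3 : ℝ) = 2 / √3 := by
    rw [Real.sqrt_eq_iff_mul_self_eq_of_pos (by positivity)]
    field_simp
    rw [h3]
    norm_num
  rw [momentum, h]
  field_simp

theorem momentum_mem_Ioo {e : ℝ} (he : e ∈ Set.Ioo (0 : ℝ) (1 / 3)) :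
    momentum e ∈ Set.Ioo 0 (1 / (3 * √3)) := by
  refine ⟨(isRadialMotion_motionRadius he).J_pos, ?_⟩
  rw [← momentum_third]
  have h1 : √(1 + e) < √(1 + 1 / 3) := Real.sqrt_lt_sqrt (by linarith [he.1]) (by linarith [he.2])
  unfold momentum
  have := mul_lt_mul'' he.2 h1 he.1.le (Real.sqrt_nonneg _)
  linarith

/-- Every `J` in the interval is `momentum e` for some `e` in `(0, 1/3)`, and continuity carries
density from `e` to `J`. -/
theorem Ioo_subset_closure_momentum_image :
    Set.Ioo 0 (1 / (3 * √3)) ⊆ closure (momentum '' rationalParameters) := by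
  intro J hJ
  have hJ' : J ∈ Set.Ioo (momentum 0) (momentum (1 / 3)) := by
    rwa [momentum_third, show momentum 0 = 0 by simp [momentum]]
  obtain ⟨e, he, rfl⟩ := intermediate_value_Ioo (by norm_num) continuous_momentum.continuousOn hJ'
  exact image_closure_subset_closure_image continuous_momentum
    ⟨e, Ioo_subset_closure_rationalParameters he, rfl⟩

end LegendrianTori

end

theorem theorem5 :
    (∀ θ α : ℝ, α ∈ Set.Ioc (0 : ℝ) 1 → (∃ q : ℚ, (q : ℝ) = α) →
      LegendrianTori.GivesMinimalLegendrianTorus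
        (LegendrianTori.equivariantMap α (LegendrianTori.profileZero θ α))) ∧
    (∃ D : Set ℝ, D ⊆ Set.Ioo 0 (1 / (3 * √3)) ∧ Set.Ioo 0 (1 / (3 * √3)) ⊆ closure D ∧
      ∀ J ∈ D, ∀ θ : ℝ, ∃ z : ℝ → LegendrianTori.C3,
        (∀ w : ℝ → LegendrianTori.C3, LegendrianTori.IsProfile θ 0 J w ↔ w = z) ∧
        LegendrianTori.GivesMinimalLegendrianTorus (LegendrianTori.equivariantMap 0 z)) := by
  refine ⟨fun θ α hα ⟨q, hq⟩ => LegendrianTori.givesMinimalLegendrianTorus_profileZero θ hα hq,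
    LegendrianTori.momentum '' LegendrianTori.rationalParameters, ?_,
    LegendrianTori.Ioo_subset_closure_momentum_image, ?_⟩
  · rintro _ ⟨e, he, rfl⟩
    exact LegendrianTori.momentum_mem_Ioo he.1
  · rintro _ ⟨e, ⟨he, q, hq⟩, rfl⟩ θ
    have hprofile := (LegendrianTori.isRadialMotion_motionRadius he).isProfile θ
    exact ⟨_, fun w => ⟨fun hw => hw.eq hprofile, fun hw => hw ▸ hprofile⟩,
      LegendrianTori.givesMinimalLegendrianTorus_neumannCurve he hq θ⟩
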